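/- \textbf{Setting.} There are $n$ arms. Arm $a$ has a known point $p_a\in\mathbb R$ and an unknown probability distribution on $[0,1]$ with mean (weight) $\mu_a$, which can be sampled independently. For a possibly unbounded interval $J=[x,y]$ let $\mathcal A(J)$ be the set of arms $a$ with $p_a\in J$. An arm $a\in\mathcal A(J)$ is $\varepsilon$-optimal for $J$ if $\mu_a\ge\mu_b-\varepsilon$ for all $b\in\mathcal A(J)$. A set $L\subseteq\mathcal A(J)$ is an $\varepsilon$-left-skyline within $J$ if for each $b\in\mathcal A(J)$ it contains an arm that is $\varepsilon$-optimal for $[p_b,y]$, and each arm of $L$ is $\varepsilon$-optimal for $[p_b,y]$ for some $b\in\mathcal A(J)$; $\varepsilon$-right-skylines are defined in the same way with the intervals $[x,p_b]$. A hitting set of intervals $I_i=[\ell_i,r_i]$, $\ell_i<r_i$, $1\le i\le q$, is a finite set $H\subset\mathbb R$ that contains, for each $i$, a point $e$ with $\ell_i<e<r_i$. \textbf{Subroutines.} Sampling algorithms $\textsc{Best},\textsc{LSkyline},\textsc{RSkyline}$ are called \emph{correct} if for all $n$, all points $p$, all $J$ and all $\varepsilon,\delta>0$, whatever the distributions of the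 arms, each of the following holds with probability at least $1-\delta$: $\textsc{Best}(J,\varepsilon,\delta)$ returns an $\varepsilon$-optimal arm for $J$ (and no arm if $\mathcal A(J)=\emptyset$), $\textsc{LSkyline}(J,\varepsilon,\delta)$ an $\varepsilon$-left-skyline within $J$, and $\textsc{RSkyline}(J,\varepsilon,\delta)$ an $\varepsilon$-right-skyline within $J$, in each case together with estimates $\widehat\mu_a$ of the weights of the returned arms such that $|\widehat\mu_a-\mu_a|\le\varepsilon$. They have \emph{sample constant} $c$ if each call draws at most $c\,\frac{|\mathcal A(J)|}{\varepsilon^2}\max\{1,\log\frac1{\varepsilon\delta}\}$ samples, whatever values are observed. \textbf{Algorithm Alg-RS.} Given $p$, intervals $I_1,\dots,I_q$, $\varepsilon,\delta>0$ and a minimum-cardinality hitting set $e_1<\dots<e_\tau$ of the intervals, put $e_0=-\infty$, $e_{\tau+1}=\infty$. For each slab $S_j=[e_j,e_{j+1}]$, $0\le j\le\tau$, call the three subroutines with parameters $\left(S_j,\frac\varepsilon3,\frac{\delta}{3(\tau+1)}\right)$, with fresh samples. Let $C$ be the collection of all returned arms with their estimates. For each $i$, output an arm $\alpha_i$ of $C$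 in $\mathcal A(I_i)$ with the largest estimate (no arm if there is none). \textbf{Theorem.} (1) There are a constant $c>0$ and correct subroutines $\textsc{Best},\textsc{LSkyline},\textsc{RSkyline}$ with sample constant $c$. (2) For every $c>0$ there is a constant $K>0$ such that, for all correct subroutines with sample constant $c$, for every $n$, every $q\ge1$, all points, all intervals $I_1,\dots,I_q$ with $\ell_i<r_i$, every minimum-cardinality hitting set (of size $\tau$) and all $\varepsilon,\delta>0$, algorithm Alg-RS run with these subroutines (a) draws at most $K\,\frac{n}{\varepsilon^2}\max\left\{1,\log\frac{\tau}{\varepsilon\delta}\right\}$ samples, whatever values are observed, and (b) is $(\varepsilon,\delta)$-PAC: whatever the distributions of the arms, with probability at least $1-\delta$ it outputs, for all $i$ simultaneously, an $\varepsilon$-optimal arm $\alpha_i$ for $I_i$ (and no arm for those $I_i$ that contain none). -/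

import Mathlib

open MeasureTheory Set

namespace BRS

/-- A sequential (adaptive) sampling procedure on `n` arms with output in `α`: either it stops and
returns an output, or it draws one sample of some arm and continues depending on the observed
value. Every draw is a fresh, independent sample of the arm. -/
inductive Strategy (n : ℕ) (α : Type) : Type
  | ret : α → Strategy n α
  | pull : Fin n → (ℝ → Strategy n α) → Strategy n α

namespace Strategy

/-- Run a procedure, then run a second one that may depend on the output of the first. -/
def bind {n : ℕ} {α β : Type} : Strategy n α → (α → Strategy n β) → Strategy n β
  | ret o, f => f o
  | pull a k, f => pull a (fun x => (k x).bind f)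

instance (n : ℕ) : Monad (Strategy n) where
  pure := Strategy.ret
  bind := Strategy.bind

open Classical in
/-- The probability that the output satisfies `S`, when every draw of arm `a` is an independent
sample from the distribution `ν a`. (For a non-measurable integrand `∫⁻` is the lower integral, so
on pathological procedures this is an inner probability and lower bounds on it are conservative.) -/
noncomputable def prob {n : ℕ} {α : Type} (ν : Fin n → Measure ℝ) (S : α → Prop) :
    Strategy n α → ENNReal
  | ret o => if S o then 1 else 0
  | pull a k => ∫⁻ x, (k x).prob ν S ∂(ν a)

/-- The procedure draws at most `N` samples in total, whatever values in `[0,1]` it observes. -/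
def DrawsAtMost {n : ℕ} {α : Type} : Strategy n α → ℝ → Prop
  | ret _, N => 0 ≤ N
  | pull _ k, N => ∀ x ∈ Icc (0 : ℝ) 1, (k x).DrawsAtMost (N - 1)

end Strategy

/-- The arms' distributions: probability measures on the reals supported on `[0,1]`. -/
def IsBandit {n : ℕ} (ν : Fin n → Measure ℝ) : Prop :=
  ∀ a, IsProbabilityMeasure (ν a) ∧ ∀ᵐ x ∂(ν a), x ∈ Icc (0 : ℝ) 1

/-- The weight of an arm: the mean of its distribution. -/
noncomputable def weight {n : ℕ} (ν : Fin n → Measure ℝ) (a : Fin n) : ℝ :=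
  ∫ x, x ∂(ν a)

open Classical in
/-- The set `𝒜([lo, hi])` of arms whose point lies in the (possibly unbounded) interval
`[lo, hi]`. -/
noncomputable def arms {n : ℕ} (p : Fin n → ℝ) (lo hi : EReal) : Finset (Fin n) :=
  Finset.univ.filter (fun a => lo ≤ (p a : EReal) ∧ (p a : EReal) ≤ hi)

/-- Arm `a` is `ε`-optimal for the interval `[lo, hi]`. -/
def EpsOptimal {n : ℕ} (μ : Fin n → ℝ) (p : Fin n → ℝ) (lo hi : EReal) (ε : ℝ) (a : Fin n) : Prop :=
  a ∈ arms p lo hi ∧ ∀ b ∈ arms p lo hi, μ b - ε ≤ μ a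

/-- `L` is an `ε`-left-skyline within the interval `[lo, hi]`. -/
def IsLeftSkyline {n : ℕ} (μ : Fin n → ℝ) (p : Fin n → ℝ) (lo hi : EReal) (ε : ℝ)
    (L : Set (Fin n)) : Prop :=
  (∀ c ∈ L, c ∈ arms p lo hi) ∧
  (∀ b ∈ arms p lo hi, ∃ c ∈ L, EpsOptimal μ p (p b) hi ε c) ∧
  (∀ c ∈ L, ∃ b ∈ arms p lo hi, EpsOptimal μ p (p b) hi ε c)

/-- `R` is an `ε`-right-skyline within the interval `[lo, hi]`. -/
def IsRightSkyline {n : ℕ} (μ : Fin n → ℝ) (p : Fin n → ℝ) (lo hi : EReal) (ε : ℝ)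
    (R : Set (Fin n)) : Prop :=
  (∀ c ∈ R, c ∈ arms p lo hi) ∧
  (∀ b ∈ arms p lo hi, ∃ c ∈ R, EpsOptimal μ p lo (p b) ε c) ∧
  (∀ c ∈ R, ∃ b ∈ arms p lo hi, EpsOptimal μ p lo (p b) ε c)

/-- A finite set of reals that meets the interior of each interval `[ℓ i, r i]`. -/
def IsHittingSet {q : ℕ} (ℓ r : Fin q → ℝ) (H : Finset ℝ) : Prop :=
  ∀ i, ∃ e ∈ H, ℓ i < e ∧ e < r i

/-- A hitting set of minimum cardinality. -/
def IsMinHittingSet {q : ℕ} (ℓ r : Fin q → ℝ) (H : Finset ℝ) : Prop :=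
  IsHittingSet ℓ r H ∧ ∀ H' : Finset ℝ, IsHittingSet ℓ r H' → H.card ≤ H'.card

/-- Code for the three subroutines. On input the points `p`, an interval `[lo, hi]`, an accuracy
and a confidence parameter, they return arms, each together with an estimate of its weight. -/
structure Subroutines where
  best : ∀ {n : ℕ}, (Fin n → ℝ) → EReal → EReal → ℝ → ℝ → Strategy n (Option (Fin n × ℝ))
  lsky : ∀ {n : ℕ}, (Fin n → ℝ) → EReal → EReal → ℝ → ℝ → Strategy n (List (Fin n × ℝ))
  rsky : ∀ {n : ℕ}, (Fin n → ℝ) → EReal → EReal → ℝ → ℝ → Strategy n (List (Fin n × ℝ))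

/-- A successful outcome for one interval: an `ε`-optimal arm is returned (and none if and only if
the interval contains no arm). -/
def FindsEpsOptimal {n : ℕ} (μ : Fin n → ℝ) (p : Fin n → ℝ) (lo hi : EReal) (ε : ℝ)
    (o : Option (Fin n)) : Prop :=
  (∀ a ∈ o, EpsOptimal μ p lo hi ε a) ∧ ((arms p lo hi).Nonempty → o.isSome)

/-- The subroutines do what they are supposed to do: with probability at least `1 - δ`, the first
finds an `ε`-optimal arm, the second an `ε`-left-skyline and the third an `ε`-right-skyline within
the given interval, with `ε`-accurate estimates of the weights of the returned arms. -/
def Subroutines.Correct (S : Subroutines) : Prop :=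
  ∀ (n : ℕ) (p : Fin n → ℝ) (lo hi : EReal) (ε δ : ℝ), 0 < ε → 0 < δ →
  ∀ ν : Fin n → Measure ℝ, IsBandit ν →
    ENNReal.ofReal (1 - δ) ≤ (S.best p lo hi ε δ).prob ν (fun o =>
      FindsEpsOptimal (weight ν) p lo hi ε (o.map Prod.fst) ∧
        ∀ x ∈ o, |weight ν x.1 - x.2| ≤ ε) ∧
    ENNReal.ofReal (1 - δ) ≤ (S.lsky p lo hi ε δ).prob ν (fun L =>
      IsLeftSkyline (weight ν) p lo hi ε {a | a ∈ L.map Prod.fst} ∧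
        ∀ x ∈ L, |weight ν x.1 - x.2| ≤ ε) ∧
    ENNReal.ofReal (1 - δ) ≤ (S.rsky p lo hi ε δ).prob ν (fun R =>
      IsRightSkyline (weight ν) p lo hi ε {a | a ∈ R.map Prod.fst} ∧
        ∀ x ∈ R, |weight ν x.1 - x.2| ≤ ε)

/-- On an interval with `m` arms, each subroutine draws at most
`c * (m / ε ^ 2) * max 1 (log (1 / (ε δ)))` samples. -/
def Subroutines.SampleBound (S : Subroutines) (c : ℝ) : Prop :=
  ∀ (n : ℕ) (p : Fin n → ℝ) (lo hi : EReal) (ε δ : ℝ), 0 < ε → 0 < δ →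
    let N : ℝ := c * ((arms p lo hi).card / ε ^ 2) * max 1 (Real.log (1 / (ε * δ)))
    (S.best p lo hi ε δ).DrawsAtMost N ∧
    (S.lsky p lo hi ε δ).DrawsAtMost N ∧
    (S.rsky p lo hi ε δ).DrawsAtMost N

/-- The slab endpoints `e 0 = -∞ < e 1 < ⋯ < e τ < e (τ + 1) = ∞`, where `e 1, …, e τ` are the
elements of `H` in increasing order. -/
noncomputable def slabEndpoint (H : Finset ℝ) (j : ℕ) : EReal :=
  (⊥ :: (H.sort (· ≤ ·)).map (fun x : ℝ => (x : EReal))).getD j ⊤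

/-- The candidates contributed by the slab `[e j, e (j + 1)]`. -/
noncomputable def slabCandidates (S : Subroutines) {n : ℕ} (p : Fin n → ℝ) (H : Finset ℝ)
    (ε δ : ℝ) (j : ℕ) : Strategy n (List (Fin n × ℝ)) := do
  let β ← S.best p (slabEndpoint H j) (slabEndpoint H (j + 1)) (ε / 3) (δ / (3 * (H.card + 1)))
  let L ← S.lsky p (slabEndpoint H j) (slabEndpoint H (j + 1)) (ε / 3) (δ / (3 * (H.card + 1)))
  let R ← S.rsky p (slabEndpoint H j) (slabEndpoint H (j + 1)) (ε / 3) (δ / (3 * (H.card + 1)))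
  return β.toList ++ L ++ R

/-- The candidates contributed by the first `m` slabs. -/
noncomputable def candidates (S : Subroutines) {n : ℕ} (p : Fin n → ℝ) (H : Finset ℝ) (ε δ : ℝ) :
    ℕ → Strategy n (List (Fin n × ℝ))
  | 0 => return []
  | m + 1 => do
      let C ← candidates S p H ε δ m
      let D ← slabCandidates S p H ε δ m
      return C ++ D

open Classical in
/-- A candidate arm of the interval `[lo, hi]` with the largest estimate (`none` if there is no
candidate in the interval). -/
noncomputable def select {n : ℕ} (p : Fin n → ℝ) (lo hi : EReal) (C : List (Fin n × ℝ)) :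
    Option (Fin n) :=
  ((C.filter (fun x => x.1 ∈ arms p lo hi)).argmax Prod.snd).map Prod.fst

/-- The algorithm `Alg-RS`, run with the subroutines `S` and the hitting set `H`: collect the
candidates of the `τ + 1` slabs, then select the best candidate for every query interval. -/
noncomputable def algRS (S : Subroutines) {n q : ℕ} (p : Fin n → ℝ) (ℓ r : Fin q → ℝ)
    (H : Finset ℝ) (ε δ : ℝ) : Strategy n (Fin q → Option (Fin n)) := do
  let C ← candidates S p H ε δ (H.card + 1)
  return fun i => select p (ℓ i) (r i) C

end BRS

/-! Existence of subroutines. A union bound over all arms would cost a factor `log n`, so everything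
rests on a left-skyline procedure `sky` that tolerates wrong estimates. Each arm of the current set
A is sampled until its estimate is ε/16-accurate up to failure probability εδ/288. If |A| ≤ 72/ε, a
union bound works and the empirical skyline is returned. Otherwise, for each level kε/8, only the
rightmost ⌊ε|A|/72⌋ + 1 arms whose estimate roughly reaches the level survive. Up to ε/4, every arm
is dominated by a survivor no further left, provided that at most ⌊ε|A|/72⌋ arms are inaccurate and
that the O(1/ε) arms which are rightmost for their true level are accurate (`covers_thin`); a single
weighted Markov bound yields both (`le_prob_sampleAll_covers`). At most |A|/4 arms survive, so
recursing with (3ε/4, δ/2) costs a geometric series. Reflection gives right skylines, and the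
largest estimate in an ε/3-skyline gives a best arm.

Alg-RS. A slab has no point of the hitting set in its interior, but every query interval does, so no
query interval lies strictly inside a slab. For an arm b of the query in a slab, the query therefore
contains the whole slab, or its part left of b, or its part right of b; the best arm, the right
skyline or the left skyline then supplies a candidate (`exists_candidate`). The accuracy ε splits
into ε/3 for the candidate and ε/3 for each of two estimates. A point lies in at most two slabs, so
the slabs hold at most 2n arms in total.

Continuations are arbitrary functions of the samples and are never shown measurable. Lower bounds on
`prob` compose as they are; concentration bounds go through `UpperExp`. -/

namespace BRS

/-! ### Probability and number of draws of composed strategies. -/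

namespace Strategy

variable {n : ℕ} {α β : Type}

theorem prob_mono {ν : Fin n → Measure ℝ} {P Q : α → Prop} (h : ∀ o, P o → Q o)
    (s : Strategy n α) : s.prob ν P ≤ s.prob ν Q := by
  induction s with
  | ret o =>
    simp only [prob]
    split_ifs with h1 h2
    · exact le_rfl
    · exact absurd (h o h1) h2
    · exact zero_le
    · exact le_rfl
  | pull a k ih => exact lintegral_mono ih

/-- Pulling a constant into a lower integral is an inequality in exactly this direction for
arbitrary integrands, so measurability plays no role. -/
theorem mul_prob_le_prob_bind {ν : Fin n → Measure ℝ} {P : α → Prop} {Q : β → Prop}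
    {f : α → Strategy n β} {c : ENNReal} (h : ∀ o, P o → c ≤ (f o).prob ν Q)
    (s : Strategy n α) : c * s.prob ν P ≤ (s.bind f).prob ν Q := by
  induction s with
  | ret o =>
    simp only [prob, bind]
    split_ifs with h1
    · simpa using h o h1
    · simp
  | pull a k ih =>
    simp only [prob, bind]
    exact (lintegral_const_mul_le _ _).trans (lintegral_mono ih)

/-- The union bound for two procedures that are run one after the other. -/
theorem le_prob_bind {ν : Fin n → Measure ℝ} {P : α → Prop} {Q : β → Prop}
    {s : Strategy n α} {f : α → Strategy n β} {x y : ℝ} (hx : 0 ≤ x) (hy : 0 ≤ y)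
    (hs : ENNReal.ofReal (1 - x) ≤ s.prob ν P)
    (hf : ∀ o, P o → ENNReal.ofReal (1 - y) ≤ (f o).prob ν Q) :
    ENNReal.ofReal (1 - (x + y)) ≤ (s.bind f).prob ν Q := by
  -- For y ≥ 1 the claim is void; otherwise 1 - y > 0, as needed to split `ENNReal.ofReal` over the
  -- product.
  rcases le_or_gt 1 y with h | h
  · rw [ENNReal.ofReal_of_nonpos (by linarith)]
    exact zero_le
  calc ENNReal.ofReal (1 - (x + y)) ≤ ENNReal.ofReal ((1 - y) * (1 - x)) :=
        ENNReal.ofReal_le_ofReal (by nlinarith)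
    _ = ENNReal.ofReal (1 - y) * ENNReal.ofReal (1 - x) := ENNReal.ofReal_mul (by linarith)
    _ ≤ ENNReal.ofReal (1 - y) * s.prob ν P := by gcongr
    _ ≤ _ := mul_prob_le_prob_bind hf s

theorem le_prob_ret {ν : Fin n → Measure ℝ} {P : α → Prop} {o : α} (h : P o) {x : ℝ}
    (hx : 0 ≤ x) : ENNReal.ofReal (1 - x) ≤ (ret o : Strategy n α).prob ν P := by
  simp only [prob, h, if_true]
  exact ENNReal.ofReal_le_one.2 (by linarith)

theorem le_prob_bind_ret {ν : Fin n → Measure ℝ} {P : α → Prop} {Q : β → Prop}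
    {s : Strategy n α} {f : α → β} {x : ℝ} (hx : 0 ≤ x)
    (hs : ENNReal.ofReal (1 - x) ≤ s.prob ν P) (hf : ∀ o, P o → Q (f o)) :
    ENNReal.ofReal (1 - x) ≤ (s.bind fun o => ret (f o)).prob ν Q := by
  simpa using le_prob_bind hx le_rfl hs fun o ho => le_prob_ret (hf o ho) le_rfl

theorem DrawsAtMost.mono {s : Strategy n α} {M N : ℝ} (h : s.DrawsAtMost M) (hMN : M ≤ N) :
    s.DrawsAtMost N := by
  induction s generalizing M N with
  | ret o => exact le_trans h hMN
  | pull a k ih => exact fun x hx => ih x (h x hx) (by linarith)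

theorem DrawsAtMost.bind {s : Strategy n α} {f : α → Strategy n β} {M N : ℝ}
    (hs : s.DrawsAtMost M) (hf : ∀ o, (f o).DrawsAtMost N) : (s.bind f).DrawsAtMost (M + N) := by
  induction s generalizing M with
  | ret o => exact (hf o).mono (by have : 0 ≤ M := hs; linarith)
  | pull a k ih =>
    intro x hx
    have := ih x (hs x hx)
    rwa [show M - 1 + N = M + N - 1 by ring] at this

theorem DrawsAtMost.bind_ret {s : Strategy n α} {f : α → β} {M : ℝ}
    (hs : s.DrawsAtMost M) : (s.bind fun o => ret (f o)).DrawsAtMost M := by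
  simpa using hs.bind (f := fun o => ret (f o)) (N := 0) fun _ => le_rfl

/-! ### Upper bounds on expectations without measurability. -/

/-- A certificate that the expectation of `φ` of the output is at most `c`, in a sense that does
not presuppose measurability: at each draw the conditional bounds have a measurable majorant. -/
def UpperExp (ν : Fin n → Measure ℝ) (φ : α → ENNReal) : Strategy n α → ENNReal → Prop
  | ret o, c => φ o ≤ c
  | pull a k, c => ∃ g : ℝ → ENNReal, Measurable g ∧ ∫⁻ x, g x ∂(ν a) ≤ c ∧
      ∀ x, (k x).UpperExp ν φ (g x)

namespace UpperExp

variable {ν : Fin n → Measure ℝ} {φ ψ : α → ENNReal} {s : Strategy n α} {c d : ENNReal}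

theorem mono (h : s.UpperExp ν φ c) (hφ : ∀ o, ψ o ≤ φ o) (hc : c ≤ d) : s.UpperExp ν ψ d := by
  induction s generalizing c d with
  | ret o => exact (hφ o).trans (le_trans h hc)
  | pull a k ih =>
    obtain ⟨g, hg, hgc, hk⟩ := h
    exact ⟨g, hg, hgc.trans hc, fun x => ih x (hk x) le_rfl⟩

theorem add (h : s.UpperExp ν φ c) (h' : s.UpperExp ν ψ d) :
    s.UpperExp ν (fun o => φ o + ψ o) (c + d) := by
  induction s generalizing c d with
  | ret o => exact add_le_add (show φ o ≤ c from h) (show ψ o ≤ d from h')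
  | pull a k ih =>
    obtain ⟨g, hg, hgc, hk⟩ := h
    obtain ⟨g', hg', hgc', hk'⟩ := h'
    refine ⟨fun x => g x + g' x, hg.add hg', ?_, fun x => ih x (hk x) (hk' x)⟩
    rw [lintegral_add_left hg]
    exact add_le_add hgc hgc'

theorem const_mul (w : ENNReal) (h : s.UpperExp ν φ c) :
    s.UpperExp ν (fun o => w * φ o) (w * c) := by
  induction s generalizing c with
  | ret o => exact mul_le_mul_right (show φ o ≤ c from h) w
  | pull a k ih =>
    obtain ⟨g, hg, hgc, hk⟩ := h
    refine ⟨fun x => w * g x, hg.const_mul w, ?_, fun x => ih x (hk x)⟩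
    rw [lintegral_const_mul _ hg]
    gcongr

theorem const (hν : IsBandit ν) (s : Strategy n α) (c : ENNReal) :
    s.UpperExp ν (fun _ => c) c := by
  induction s with
  | ret o => exact le_rfl
  | pull a k ih =>
    have := (hν a).1
    exact ⟨fun _ => c, measurable_const, by simp, ih⟩

theorem sum (hν : IsBandit ν) {ι : Type} (A : Finset ι) {φ : ι → α → ENNReal} {c : ι → ENNReal}
    (h : ∀ i ∈ A, s.UpperExp ν (φ i) (c i)) :
    s.UpperExp ν (fun o => ∑ i ∈ A, φ i o) (∑ i ∈ A, c i) := by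
  classical
  induction A using Finset.induction_on with
  | empty => simpa using const hν s 0
  | insert i A hi ih =>
    simp only [Finset.sum_insert hi]
    exact (h i (Finset.mem_insert_self _ _)).add
      (ih fun j hj => h j (Finset.mem_insert_of_mem hj))

theorem bind {f : α → Strategy n β} {χ : β → ENNReal} (hs : s.UpperExp ν φ c)
    (hf : ∀ o, (f o).UpperExp ν χ (φ o)) : (s.bind f).UpperExp ν χ c := by
  induction s generalizing c with
  | ret o => exact (hf o).mono (fun _ => le_rfl) hs
  | pull a k ih =>
    obtain ⟨g, hg, hgc, hk⟩ := hs
    exact ⟨g, hg, hgc, fun x => ih x (hk x)⟩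

/-- Markov's inequality for the failure event. The measurable majorant `g` is what permits
subtracting under the lower integral. -/
theorem one_sub_le_prob (hν : IsBandit ν) {P : α → Prop} (h : s.UpperExp ν φ c)
    (hP : ∀ o, ¬ P o → 1 ≤ φ o) : 1 - c ≤ s.prob ν P := by
  induction s generalizing c with
  | ret o =>
    simp only [prob]
    split_ifs with ho
    · exact tsub_le_self
    · exact (tsub_eq_zero_of_le ((hP o ho).trans h)).le
  | pull a k ih =>
    obtain ⟨g, hg, hgc, hk⟩ := h
    have := (hν a).1
    calc 1 - c ≤ ∫⁻ _, 1 ∂(ν a) - ∫⁻ x, g x ∂(ν a) := by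
          simpa using tsub_le_tsub_left hgc 1
      _ ≤ ∫⁻ x, (1 - g x) ∂(ν a) := lintegral_sub_le _ _ hg
      _ ≤ _ := lintegral_mono fun x => ih x (hk x)

end UpperExp

end Strategy

open Strategy

variable {n : ℕ}

/-! ### Empirical means and their concentration. -/

/-- Draw `s` samples of arm `a` and add their sum to `acc`. -/
def sampleSum (a : Fin n) : ℕ → ℝ → Strategy n ℝ
  | 0, acc => .ret acc
  | s + 1, acc => .pull a fun x => sampleSum a s (acc + x)

/-- The empirical mean of `s` samples of arm `a`. -/
noncomputable def sampleMean (a : Fin n) (s : ℕ) : Strategy n ℝ :=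
  (sampleSum a s 0).bind fun t => .ret (t / s)

theorem sampleSum_drawsAtMost (a : Fin n) (s : ℕ) (acc : ℝ) :
    (sampleSum a s acc).DrawsAtMost s := by
  induction s generalizing acc with
  | zero => simp [sampleSum, DrawsAtMost]
  | succ s ih =>
    intro x _
    simpa using ih (acc + x)

theorem sampleMean_drawsAtMost (a : Fin n) (s : ℕ) : (sampleMean a s).DrawsAtMost s :=
  (sampleSum_drawsAtMost a s 0).bind_ret

theorem upperExp_exp_sampleSum (ν : Fin n → Measure ℝ) (a : Fin n) (t : ℝ) (s : ℕ) (acc : ℝ) :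
    (sampleSum a s acc).UpperExp ν (fun y => ENNReal.ofReal (Real.exp (t * y)))
      (ENNReal.ofReal (Real.exp (t * acc)) *
        (∫⁻ x, ENNReal.ofReal (Real.exp (t * x)) ∂(ν a)) ^ s) := by
  induction s generalizing acc with
  | zero => simp [sampleSum, UpperExp]
  | succ s ih =>
    refine ⟨_, ?_, ?_, fun x => ih (acc + x)⟩
    · fun_prop
    · have : ∀ x : ℝ, ENNReal.ofReal (Real.exp (t * (acc + x))) *
          (∫⁻ x, ENNReal.ofReal (Real.exp (t * x)) ∂(ν a)) ^ s =
          (ENNReal.ofReal (Real.exp (t * acc)) *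
            (∫⁻ x, ENNReal.ofReal (Real.exp (t * x)) ∂(ν a)) ^ s) *
            ENNReal.ofReal (Real.exp (t * x)) := by
        intro x
        rw [mul_add, Real.exp_add, ENNReal.ofReal_mul (Real.exp_pos _).le]
        ring
      simp only [this]
      rw [lintegral_const_mul _ (by fun_prop), pow_succ, mul_assoc]

/-- Hoeffding's lemma: a variable in [0,1] is sub-Gaussian with variance proxy 1/4 after centring.
-/
theorem lintegral_exp_le {ν : Fin n → Measure ℝ} (hν : IsBandit ν) (a : Fin n) (t : ℝ) :
    ∫⁻ x, ENNReal.ofReal (Real.exp (t * x)) ∂(ν a) ≤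
      ENNReal.ofReal (Real.exp (t * weight ν a + t ^ 2 / 8)) := by
  have := (hν a).1
  have h := ProbabilityTheory.hasSubgaussianMGF_of_mem_Icc (μ := ν a) (X := fun x : ℝ => x)
    aemeasurable_id (hν a).2
  have hmgf := h.mgf_le t
  have hint := h.integrable_exp_mul t
  rw [ProbabilityTheory.mgf] at hmgf
  have hfac : ∀ x : ℝ, ENNReal.ofReal (Real.exp (t * x)) =
      ENNReal.ofReal (Real.exp (t * weight ν a)) *
        ENNReal.ofReal (Real.exp (t * (x - ∫ y, y ∂(ν a)))) := by
    intro x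
    rw [← ENNReal.ofReal_mul (Real.exp_pos _).le, ← Real.exp_add, weight]
    ring_nf
  rw [lintegral_congr hfac, lintegral_const_mul' _ _ ENNReal.ofReal_ne_top,
    ← ofReal_integral_eq_lintegral_ofReal hint (ae_of_all _ fun _ => (Real.exp_pos _).le),
    ← ENNReal.ofReal_mul (Real.exp_pos _).le, Real.exp_add]
  gcongr
  refine hmgf.trans_eq ?_
  congr 1
  simp
  ring

/-- Hoeffding's inequality for the empirical mean. -/
theorem upperExp_sampleMean {ν : Fin n → Measure ℝ} (hν : IsBandit ν) (a : Fin n) {s : ℕ}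
    (hs : 0 < s) {θ κ : ℝ} (hθ : 0 < θ) (hκ : 2 * Real.exp (-(2 * s * θ ^ 2)) ≤ κ) :
    (sampleMean a s).UpperExp ν ({y | θ < |y - weight ν a|}.indicator 1) (ENNReal.ofReal κ) := by
  set μ := weight ν a
  have hs' : (0 : ℝ) < s := by exact_mod_cast hs
  -- The Chernoff exponent st²/8 - |t|sθ is minimal at t = ±4θ, with value -2sθ²; the two signs
  -- treat the two tails.
  have key : ∀ t : ℝ, t ^ 2 = (4 * θ) ^ 2 → (sampleSum a s 0).UpperExp ν
      (fun y => ENNReal.ofReal (Real.exp (-(t * (s * μ)) - 4 * θ ^ 2 * s)) *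
        ENNReal.ofReal (Real.exp (t * y))) (ENNReal.ofReal (Real.exp (-(2 * s * θ ^ 2)))) := by
    intro t ht
    refine ((upperExp_exp_sampleSum ν a t s 0).const_mul _).mono (fun _ => le_rfl) ?_
    calc _ ≤ ENNReal.ofReal (Real.exp (-(t * (s * μ)) - 4 * θ ^ 2 * s)) *
          (ENNReal.ofReal (Real.exp (t * 0)) *
            ENNReal.ofReal (Real.exp (t * μ + t ^ 2 / 8)) ^ s) := by
          gcongr
          exact lintegral_exp_le hν a t
      _ = _ := by
          rw [← ENNReal.ofReal_pow (Real.exp_pos _).le, ← Real.exp_nat_mul,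
            ← ENNReal.ofReal_mul (Real.exp_pos _).le, ← ENNReal.ofReal_mul (Real.exp_pos _).le,
            ← Real.exp_add, ← Real.exp_add, ht]
          ring_nf
  refine UpperExp.bind (((key (4 * θ) rfl).add (key (-(4 * θ)) (by ring))).mono (fun _ => le_rfl)
    (d := ENNReal.ofReal κ) ?_) fun y => ?_
  · rw [← ENNReal.ofReal_add (Real.exp_pos _).le (Real.exp_pos _).le]
    exact ENNReal.ofReal_le_ofReal (by linarith)
  · change indicator _ 1 (y / s) ≤ _
    rw [← ENNReal.ofReal_mul (Real.exp_pos _).le, ← ENNReal.ofReal_mul (Real.exp_pos _).le,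
      ← Real.exp_add, ← Real.exp_add]
    by_cases h : θ < |y / s - μ|
    · rw [indicator_of_mem (by exact h)]
      have hy : y = s * (y / s) := by field_simp
      set z := y / s
      rcases lt_abs.1 h with h | h
      · refine le_trans ?_ le_self_add
        simp only [Pi.one_apply, ENNReal.one_le_ofReal, Real.one_le_exp_iff]
        have : 0 ≤ (4 * θ * s) * (z - μ - θ) := by
          have : 0 < z - μ - θ := by linarith
          positivity
        rw [hy]; nlinarith
      · refine le_trans ?_ le_add_self
        simp only [Pi.one_apply, ENNReal.one_le_ofReal, Real.one_le_exp_iff]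
        have : 0 ≤ (4 * θ * s) * (-(z - μ) - θ) := by
          have : 0 < -(z - μ) - θ := by linarith
          positivity
        rw [hy]; nlinarith
    · rw [indicator_of_notMem (by exact h)]
      exact zero_le

/-- Sample each arm of a list `s` times and return the empirical means. -/
noncomputable def sampleAll (s : ℕ) : List (Fin n) → Strategy n (Fin n → ℝ)
  | [] => .ret fun _ => 0
  | a :: l => (sampleMean a s).bind fun y =>
      (sampleAll s l).bind fun e => .ret (Function.update e a y)

theorem sampleAll_drawsAtMost (s : ℕ) (l : List (Fin n)) :
    (sampleAll s l).DrawsAtMost (l.length * s) := by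
  induction l with
  | nil => simp [sampleAll, DrawsAtMost]
  | cons a l ih =>
    refine ((sampleMean_drawsAtMost a s).bind fun y => ih.bind_ret).mono ?_
    push_cast [List.length_cons]
    linarith

/-- Marginal bounds for single arms suffice, since they are only combined linearly later. -/
theorem upperExp_sampleAll {ν : Fin n → Measure ℝ} (hν : IsBandit ν) {s : ℕ}
    (hs : 0 < s) {θ κ : ℝ} (hθ : 0 < θ) (hκ : 2 * Real.exp (-(2 * s * θ ^ 2)) ≤ κ)
    {l : List (Fin n)} (hl : l.Nodup) {a : Fin n} (ha : a ∈ l) :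
    (sampleAll s l).UpperExp ν ({e | θ < |e a - weight ν a|}.indicator 1)
      (ENNReal.ofReal κ) := by
  induction l with
  | nil => simp at ha
  | cons b l ih =>
    rw [List.nodup_cons] at hl
    by_cases hab : a = b
    · subst hab
      refine (upperExp_sampleMean hν a hs hθ hκ).bind fun y =>
        (UpperExp.const hν _ _).bind fun e => le_of_eq ?_
      simp [indicator]
    · refine (UpperExp.const hν _ _).bind fun y =>
        (ih hl.2 (by simpa [hab] using ha)).bind fun e => le_of_eq ?_
      simp [indicator, hab]

open Classical in
/-- A weighted Markov bound for the set of arms with an inaccurate estimate. -/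
theorem le_prob_sampleAll {ν : Fin n → Measure ℝ} (hν : IsBandit ν) {s : ℕ}
    (hs : 0 < s) {θ κ : ℝ} (hθ : 0 < θ) (hκ : 2 * Real.exp (-(2 * s * θ ^ 2)) ≤ κ)
    (A : Finset (Fin n)) {w : Fin n → ℝ} (hw : ∀ a, 0 ≤ w a) {P : (Fin n → ℝ) → Prop}
    (hP : ∀ e, ¬ P e → 1 ≤ ∑ a ∈ A with θ < |e a - weight ν a|, w a) :
    ENNReal.ofReal (1 - (∑ a ∈ A, w a) * κ) ≤ (sampleAll s A.toList).prob ν P := by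
  have hκ0 : 0 ≤ κ := le_trans (by positivity) hκ
  have h := UpperExp.sum hν A fun a ha =>
    (upperExp_sampleAll hν hs hθ hκ A.nodup_toList (Finset.mem_toList.2 ha)).const_mul
      (ENNReal.ofReal (w a))
  refine le_trans (le_of_eq ?_) (h.one_sub_le_prob hν (P := P) fun e he => ?_)
  · rw [ENNReal.ofReal_sub _ (mul_nonneg (Finset.sum_nonneg fun a _ => hw a) hκ0),
      ENNReal.ofReal_one, ← Finset.sum_mul, ENNReal.ofReal_mul (Finset.sum_nonneg fun a _ => hw a),
      ENNReal.ofReal_sum_of_nonneg fun a _ => hw a]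
  · have := ENNReal.ofReal_le_ofReal (hP e he)
    rw [ENNReal.ofReal_one, ENNReal.ofReal_sum_of_nonneg fun a _ => hw a,
      Finset.sum_filter] at this
    refine this.trans (Finset.sum_le_sum fun a _ => ?_)
    by_cases h : θ < |e a - weight ν a| <;> simp [indicator, h]

/-! ### Skylines and coverings of sets of arms. -/

/-- The list `L` of arms with estimates is an `ε`-left-skyline, with `ε`-accurate estimates, of the
set `A` of arms. -/
def IsSkyline (μ p : Fin n → ℝ) (A : Finset (Fin n)) (ε : ℝ) (L : List (Fin n × ℝ)) : Prop :=
  (∀ x ∈ L, x.1 ∈ A) ∧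
  (∀ b ∈ A, ∃ x ∈ L, p b ≤ p x.1 ∧ ∀ d ∈ A, p b ≤ p d → μ d - ε ≤ μ x.1) ∧
  (∀ x ∈ L, ∀ d ∈ A, p x.1 ≤ p d → μ d - ε ≤ μ x.1) ∧
  ∀ x ∈ L, |μ x.1 - x.2| ≤ ε

/-- Each arm of `A` is dominated by an arm of `A'`, up to `ε`. -/
def Covers (μ p : Fin n → ℝ) (A' A : Finset (Fin n)) (ε : ℝ) : Prop :=
  ∀ b ∈ A, ∃ c ∈ A', p b ≤ p c ∧ μ b - ε ≤ μ c

theorem IsSkyline.of_covers {μ p : Fin n → ℝ} {A A' : Finset (Fin n)} {ε η : ℝ} (hη : 0 ≤ η)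
    {L : List (Fin n × ℝ)} (hL : IsSkyline μ p A' ε L) (hA : A' ⊆ A) (hc : Covers μ p A' A η) :
    IsSkyline μ p A (ε + η) L := by
  obtain ⟨h1, h2, h3, h4⟩ := hL
  refine ⟨fun x hx => hA (h1 x hx), fun b hb => ?_, fun x hx d hd hxd => ?_, fun x hx => ?_⟩
  · obtain ⟨b', hb', hpb, -⟩ := hc b hb
    -- One returned arm has to beat all arms right of b at once: it is the one serving the cover of
    -- the heaviest of them.
    obtain ⟨m, hm, hmax⟩ := Finset.exists_max_image (A.filter fun d => p b ≤ p d) μ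
      ⟨b, by simp [hb]⟩
    rw [Finset.mem_filter] at hm
    obtain ⟨c, hcA, hpc, hμc⟩ := hc m hm.1
    obtain ⟨x, hx, hpx, hμx⟩ := h2 c hcA
    refine ⟨x, hx, hm.2.trans (hpc.trans hpx), fun d hd hbd => ?_⟩
    have := hmax d (by simp [hd, hbd])
    have := hμx c hcA le_rfl
    linarith
  · obtain ⟨c, hcA, hpc, hμc⟩ := hc d hd
    have := h3 x hx c hcA (hxd.trans hpc)
    linarith
  · linarith [h4 x hx]

/-- The arms of `A` whose estimate is not exceeded by an arm of `A` further to the right. -/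
noncomputable def empiricalSkyline (p : Fin n → ℝ) (A : Finset (Fin n)) (e : Fin n → ℝ) :
    List (Fin n × ℝ) :=
  (A.filter fun a => ∀ d ∈ A, p a ≤ p d → e d ≤ e a).toList.map fun a => (a, e a)

/-- Comparing two estimates orders the weights up to 2θ, and the empirically best arm right of b
belongs to the empirical skyline. -/
theorem isSkyline_empiricalSkyline {μ p : Fin n → ℝ} {A : Finset (Fin n)} {e : Fin n → ℝ}
    {θ ε : ℝ} (he : ∀ a ∈ A, |e a - μ a| ≤ θ) (hε : 2 * θ ≤ ε) (hε0 : θ ≤ ε) :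
    IsSkyline μ p A ε (empiricalSkyline p A e) := by
  have hmem : ∀ x : Fin n × ℝ, x ∈ empiricalSkyline p A e ↔
      (x.1 ∈ A ∧ ∀ d ∈ A, p x.1 ≤ p d → e d ≤ e x.1) ∧ x.2 = e x.1 := by
    rintro ⟨a, y⟩
    simp only [empiricalSkyline, List.mem_map, Finset.mem_toList, Finset.mem_filter, Prod.mk.injEq]
    constructor
    · rintro ⟨a, h, rfl, rfl⟩
      exact ⟨h, rfl⟩
    · rintro ⟨h, rfl⟩
      exact ⟨a, h, rfl, rfl⟩
  have hle : ∀ a ∈ A, ∀ d ∈ A, e d ≤ e a → μ d - ε ≤ μ a := by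
    intro a ha d hd h
    have := abs_le.1 (he a ha)
    have := abs_le.1 (he d hd)
    linarith
  refine ⟨fun x hx => ((hmem x).1 hx).1.1, fun b hb => ?_, fun x hx d hd hxd => ?_,
    fun x hx => ?_⟩
  · obtain ⟨c, hc, hmax⟩ := Finset.exists_max_image (A.filter fun d => p b ≤ p d) e
      ⟨b, by simp [hb]⟩
    rw [Finset.mem_filter] at hc
    refine ⟨(c, e c), (hmem _).2 ⟨⟨hc.1, fun d hd hcd => hmax d ?_⟩, rfl⟩, hc.2,
      fun d hd hbd => hle c hc.1 d hd (hmax d ?_)⟩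
    · simp [hd, hc.2.trans hcd]
    · simp [hd, hbd]
  · obtain ⟨⟨hx, hmax⟩, -⟩ := (hmem x).1 hx
    exact hle _ hx d hd (hmax d hd hxd)
  · obtain ⟨⟨hx, -⟩, hx2⟩ := (hmem x).1 hx
    rw [hx2, abs_sub_comm]
    exact (he _ hx).trans hε0

/-- Greedy choice, which also settles ties: an arm is left out only if m chosen arms lie at least as
far right. -/
theorem exists_rightmost (p : Fin n → ℝ) (E : Finset (Fin n)) (m : ℕ) :
    ∃ T ⊆ E, T.card ≤ m ∧ ∀ a ∈ E, a ∉ T → m ≤ T.card ∧ ∀ d ∈ T, p a ≤ p d := by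
  induction m with
  | zero => exact ⟨∅, by simp, by simp, by simp⟩
  | succ m ih =>
    obtain ⟨T, hTE, hT, hmax⟩ := ih
    rcases (E \ T).eq_empty_or_nonempty with h | h
    · exact ⟨T, hTE, by omega, fun a ha haT => absurd (Finset.mem_sdiff.2 ⟨ha, haT⟩) (by simp [h])⟩
    · obtain ⟨c, hc, hcmax⟩ := Finset.exists_max_image _ p h
      rw [Finset.mem_sdiff] at hc
      have hcard := (hmax c hc.1 hc.2).1
      refine ⟨insert c T, Finset.insert_subset hc.1 hTE, ?_, fun a ha haT => ?_⟩
      · rw [Finset.card_insert_of_notMem hc.2]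
        omega
      · rw [Finset.mem_insert, not_or] at haT
        rw [Finset.card_insert_of_notMem hc.2]
        refine ⟨by omega, fun d hd => ?_⟩
        rcases Finset.mem_insert.1 hd with rfl | hd
        · exact hcmax a (Finset.mem_sdiff.2 ⟨ha, haT.2⟩)
        · exact (hmax a ha haT.2).2 d hd

/-- The `m` rightmost arms of `E` (all arms if there are fewer). -/
noncomputable def rightmost (p : Fin n → ℝ) (E : Finset (Fin n)) (m : ℕ) : Finset (Fin n) :=
  (exists_rightmost p E m).choose

theorem rightmost_spec (p : Fin n → ℝ) (E : Finset (Fin n)) (m : ℕ) :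
    rightmost p E m ⊆ E ∧ (rightmost p E m).card ≤ m ∧
      ∀ a ∈ E, a ∉ rightmost p E m →
        m ≤ (rightmost p E m).card ∧ ∀ d ∈ rightmost p E m, p a ≤ p d :=
  (exists_rightmost p E m).choose_spec

/-! ### Thinning a set of arms. -/

/-- For each multiple of `ε / 8` in `[0, 1]`, keep the rightmost `ε |A| / 72` arms whose estimate
reaches that level approximately. -/
noncomputable def thin (p : Fin n → ℝ) (A : Finset (Fin n)) (ε : ℝ) (e : Fin n → ℝ) :
    Finset (Fin n) :=
  (Finset.range (⌊8 / ε⌋₊ + 1)).biUnion fun k =>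
    rightmost p (A.filter fun a => k * (ε / 8) - ε / 16 ≤ e a) (⌊ε * A.card / 72⌋₊ + 1)

theorem thin_subset (p : Fin n → ℝ) (A : Finset (Fin n)) (ε : ℝ) (e : Fin n → ℝ) :
    thin p A ε e ⊆ A :=
  Finset.biUnion_subset.2 fun _ _ => (rightmost_spec _ _ _).1.trans (Finset.filter_subset _ _)

/-- At most 9/ε levels with ε|A|/72 + 1 arms each make |A|/8 + 9/ε, and 9/ε < |A|/8 for large A. -/
theorem card_thin_le (p : Fin n → ℝ) {A : Finset (Fin n)} {ε : ℝ} (hε : 0 < ε) (hε1 : ε ≤ 1)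
    (hA : 72 / ε < A.card) (e : Fin n → ℝ) : ((thin p A ε e).card : ℝ) ≤ A.card / 4 := by
  have h1 : (thin p A ε e).card ≤ (⌊8 / ε⌋₊ + 1) * (⌊ε * A.card / 72⌋₊ + 1) := by
    have h := Finset.card_biUnion_le_card_mul (Finset.range (⌊8 / ε⌋₊ + 1)) _ _
      fun k _ => (rightmost_spec p (A.filter fun a => k * (ε / 8) - ε / 16 ≤ e a)
        (⌊ε * A.card / 72⌋₊ + 1)).2.1
    rwa [Finset.card_range] at h
  have h2 : ((⌊8 / ε⌋₊ + 1 : ℕ) : ℝ) ≤ 9 / ε := by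
    have := Nat.floor_le (show 0 ≤ 8 / ε by positivity)
    have : 1 ≤ 1 / ε := (one_le_div hε).2 hε1
    push_cast
    have : 9 / ε = 8 / ε + 1 / ε := by ring
    linarith
  have h3 : ((⌊ε * A.card / 72⌋₊ + 1 : ℕ) : ℝ) ≤ ε * A.card / 72 + 1 := by
    have := Nat.floor_le (show 0 ≤ ε * A.card / 72 by positivity)
    push_cast
    linarith
  calc ((thin p A ε e).card : ℝ)
      ≤ ((⌊8 / ε⌋₊ + 1 : ℕ) : ℝ) * ((⌊ε * A.card / 72⌋₊ + 1 : ℕ) : ℝ) := by exact_mod_cast h1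
    _ ≤ 9 / ε * (ε * A.card / 72 + 1) := by gcongr
    _ = A.card / 8 + 72 / ε / 8 := by field_simp; norm_num
    _ ≤ A.card / 4 := by linarith

/-- A small set of arms that contains, for each level `k * η` with `k < N`, the rightmost arm whose
weight reaches that level. -/
theorem exists_targets (μ p : Fin n → ℝ) (A : Finset (Fin n)) (η : ℝ) (N : ℕ) :
    ∃ T ⊆ A, T.card ≤ N ∧ ∀ k < N, ∀ b ∈ A, k * η ≤ μ b → ∃ t ∈ T, k * η ≤ μ t ∧ p b ≤ p t := by
  induction N with
  | zero => exact ⟨∅, by simp⟩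
  | succ N ih =>
    obtain ⟨T, hTA, hT, hcov⟩ := ih
    rcases (A.filter fun a => N * η ≤ μ a).eq_empty_or_nonempty with h | h
    · refine ⟨T, hTA, by omega, fun k hk b hb hkb => ?_⟩
      rcases Nat.lt_succ_iff_lt_or_eq.1 hk with hk | rfl
      · exact hcov k hk b hb hkb
      · exact absurd hkb (Finset.filter_eq_empty_iff.1 h hb)
    · obtain ⟨c, hc, hmax⟩ := Finset.exists_max_image _ p h
      rw [Finset.mem_filter] at hc
      refine ⟨insert c T, Finset.insert_subset hc.1 hTA,
        (Finset.card_insert_le _ _).trans (by omega), fun k hk b hb hkb => ?_⟩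
      rcases Nat.lt_succ_iff_lt_or_eq.1 hk with hk | rfl
      · obtain ⟨t, ht, h⟩ := hcov k hk b hb hkb
        exact ⟨t, Finset.mem_insert_of_mem ht, h⟩
      · exact ⟨c, Finset.mem_insert_self _ _, hc.2, hmax b (Finset.mem_filter.2 ⟨hb, hkb⟩)⟩

-- Let k be the level of b and t its target. An accurate t passes the filter of level k. Either t
-- survives, or ⌊ε|A|/72⌋ + 1 arms no further left do; these outnumber the inaccurate arms, so one
-- of them has weight at least kε/8 - ε/8, which is more than the weight of b minus ε/4.
open Classical in
theorem covers_thin {μ p : Fin n → ℝ} {A T : Finset (Fin n)} {ε : ℝ} (hε : 0 < ε)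
    (hμ : ∀ a, μ a ∈ Icc (0 : ℝ) 1) (hTA : T ⊆ A)
    (hT : ∀ k < ⌊8 / ε⌋₊ + 1, ∀ b ∈ A, k * (ε / 8) ≤ μ b →
      ∃ t ∈ T, k * (ε / 8) ≤ μ t ∧ p b ≤ p t)
    {e : Fin n → ℝ} (heT : ∀ t ∈ T, |e t - μ t| ≤ ε / 16)
    (heA : (A.filter fun a => ε / 16 < |e a - μ a|).card ≤ ⌊ε * A.card / 72⌋₊) :
    Covers μ p (thin p A ε e) A (ε / 4) := by
  intro b hb
  have hb0 : 0 ≤ μ b / (ε / 8) := div_nonneg (hμ b).1 (by positivity)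
  set k := ⌊μ b / (ε / 8)⌋₊ with hk
  have hkb : k * (ε / 8) ≤ μ b := (le_div_iff₀ (by positivity)).1 (Nat.floor_le hb0)
  have hbk : μ b < (k + 1) * (ε / 8) := (div_lt_iff₀ (by positivity)).1 (Nat.lt_floor_add_one _)
  have hkN : k < ⌊8 / ε⌋₊ + 1 := by
    refine Nat.lt_succ_of_le (Nat.floor_le_floor ?_)
    calc μ b / (ε / 8) ≤ 1 / (ε / 8) := by
          gcongr
          exact (hμ b).2
      _ = 8 / ε := by field_simp
  obtain ⟨t, htT, hkt, hbt⟩ := hT k hkN b hb hkb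
  set E := A.filter fun a => k * (ε / 8) - ε / 16 ≤ e a with hE
  set m := ⌊ε * A.card / 72⌋₊ with hm
  have hsub : rightmost p E (m + 1) ⊆ thin p A ε e :=
    Finset.subset_biUnion_of_mem (fun k : ℕ => rightmost p (A.filter fun a =>
      k * (ε / 8) - ε / 16 ≤ e a) (⌊ε * A.card / 72⌋₊ + 1)) (Finset.mem_range.2 hkN)
  obtain ⟨hRE, -, hR⟩ := rightmost_spec p E (m + 1)
  have htE : t ∈ E := by
    have := abs_le.1 (heT t htT)
    exact Finset.mem_filter.2 ⟨hTA htT, by linarith⟩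
  by_cases htR : t ∈ rightmost p E (m + 1)
  · exact ⟨t, hsub htR, hbt, by linarith⟩
  · obtain ⟨hcard, hright⟩ := hR t htE htR
    obtain ⟨c, hcR, hc⟩ := Finset.exists_mem_notMem_of_card_lt_card (lt_of_le_of_lt heA hcard)
    obtain ⟨hcA, hce⟩ := Finset.mem_filter.1 (hRE hcR)
    have hcg : |e c - μ c| ≤ ε / 16 := by
      by_contra! h
      exact hc (Finset.mem_filter.2 ⟨hcA, h⟩)
    have := abs_le.1 hcg
    exact ⟨c, hsub hcR, hbt.trans (hright c hcR), by linarith⟩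

/-! ### The recursive skyline procedure: cost and correctness. -/

/-- The number of samples that makes an empirical mean `ε / 16`-accurate with probability
`1 - ε δ / 288`. -/
noncomputable def numSamples (ε δ : ℝ) : ℕ := ⌈128 / ε ^ 2 * Real.log (576 / (ε * δ))⌉₊

theorem one_le_log {ε δ : ℝ} (hε : 0 < ε) (hε1 : ε ≤ 1) (hδ : 0 < δ) (hδ1 : δ ≤ 1) :
    1 ≤ Real.log (576 / (ε * δ)) := by
  rw [Real.le_log_iff_exp_le (by positivity)]
  have : 576 ≤ 576 / (ε * δ) := by
    rw [le_div_iff₀ (by positivity)]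
    nlinarith [mul_le_one₀ hε1 hδ.le hδ1]
  linarith [Real.exp_one_lt_d9]

theorem numSamples_pos {ε δ : ℝ} (hε : 0 < ε) (hε1 : ε ≤ 1) (hδ : 0 < δ) (hδ1 : δ ≤ 1) :
    0 < numSamples ε δ := by
  have := one_le_log hε hε1 hδ hδ1
  exact Nat.ceil_pos.2 (by positivity)

theorem numSamples_le {ε δ : ℝ} (hε : 0 < ε) (hε1 : ε ≤ 1) (hδ : 0 < δ) (hδ1 : δ ≤ 1) :
    (numSamples ε δ : ℝ) ≤ 129 / ε ^ 2 * Real.log (576 / (ε * δ)) := by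
  have hlog := one_le_log hε hε1 hδ hδ1
  have h := Nat.ceil_lt_add_one (show 0 ≤ 128 / ε ^ 2 * Real.log (576 / (ε * δ)) by positivity)
  have h1 : 1 ≤ 1 / ε ^ 2 * Real.log (576 / (ε * δ)) :=
    one_le_mul_of_one_le_of_one_le ((one_le_div (by positivity)).2 (pow_le_one₀ hε.le hε1)) hlog
  have : 129 / ε ^ 2 * Real.log (576 / (ε * δ)) =
    128 / ε ^ 2 * Real.log (576 / (ε * δ)) + 1 / ε ^ 2 * Real.log (576 / (ε * δ)) := by ring
  rw [numSamples]
  linarith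

theorem exp_numSamples_le {ε δ : ℝ} (hε : 0 < ε) (hδ : 0 < δ) :
    2 * Real.exp (-(2 * numSamples ε δ * (ε / 16) ^ 2)) ≤ ε * δ / 288 := by
  have h : 128 / ε ^ 2 * Real.log (576 / (ε * δ)) ≤ numSamples ε δ := Nat.le_ceil _
  have h2 : Real.log (576 / (ε * δ)) ≤ 2 * numSamples ε δ * (ε / 16) ^ 2 := by
    calc Real.log (576 / (ε * δ)) =
        128 / ε ^ 2 * Real.log (576 / (ε * δ)) * (ε ^ 2 / 128) := by field_simp
      _ ≤ numSamples ε δ * (ε ^ 2 / 128) := by gcongr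
      _ = _ := by ring
  have h3 : Real.exp (-(2 * numSamples ε δ * (ε / 16) ^ 2)) ≤
      Real.exp (-Real.log (576 / (ε * δ))) := Real.exp_le_exp.2 (by linarith)
  rw [Real.exp_neg (Real.log _), Real.exp_log (by positivity), inv_div] at h3
  linarith

/-- Sample all arms of `A`, thin them out and recurse until few arms are left; `k` bounds the
number of rounds. -/
noncomputable def sky (p : Fin n → ℝ) :
    ℕ → Finset (Fin n) → ℝ → ℝ → Strategy n (List (Fin n × ℝ))
  | 0, _, _, _ => .ret []
  | k + 1, A, ε, δ => (sampleAll (numSamples ε δ) A.toList).bind fun e =>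
      open Classical in
      if (A.card : ℝ) ≤ 72 / ε then .ret (empiricalSkyline p A e)
      else sky p k (thin p A ε e) (3 * ε / 4) (δ / 2)

/-- With X = |A|/ε² · log(576/(εδ)), one round costs at most 129 X. The recursive call multiplies X
by at most 1/4 · 16/9 · 2 = 8/9, and 129/(1 - 8/9) = 1161. -/
theorem sky_drawsAtMost (p : Fin n → ℝ) (k : ℕ) (A : Finset (Fin n)) {ε δ : ℝ} (hε : 0 < ε)
    (hε1 : ε ≤ 1) (hδ : 0 < δ) (hδ1 : δ ≤ 1) :
    (sky p k A ε δ).DrawsAtMost (1161 * (A.card / ε ^ 2) * Real.log (576 / (ε * δ))) := by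
  induction k generalizing A ε δ with
  | zero =>
    have := one_le_log hε hε1 hδ hδ1
    change 0 ≤ _
    positivity
  | succ k ih =>
    have hlog := one_le_log hε hε1 hδ hδ1
    set X := A.card / ε ^ 2 * Real.log (576 / (ε * δ)) with hX
    have hX0 : 0 ≤ X := by positivity
    have h1 : (A.toList.length : ℝ) * numSamples ε δ ≤ 129 * X := by
      rw [Finset.length_toList]
      calc (A.card : ℝ) * numSamples ε δ ≤
            A.card * (129 / ε ^ 2 * Real.log (576 / (ε * δ))) := by
            gcongr
            exact numSamples_le hε hε1 hδ hδ1
        _ = _ := by rw [hX]; ring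
    refine (((sampleAll_drawsAtMost _ _).mono h1).bind (N := 1032 * X) fun e => ?_).mono
      (by rw [hX]; ring_nf; exact le_rfl)
    split_ifs with hA
    · change 0 ≤ _
      positivity
    · refine (ih (thin p A ε e) (ε := 3 * ε / 4) (δ := δ / 2) (by linarith) (by linarith)
        (by linarith) (by linarith)).mono ?_
      have h2 : Real.log (576 / (3 * ε / 4 * (δ / 2))) ≤ 2 * Real.log (576 / (ε * δ)) := by
        have h3 : 576 / (3 * ε / 4 * (δ / 2)) = 8 / 3 * (576 / (ε * δ)) := by field_simp; norm_num
        have h4 : Real.log (8 / 3) ≤ 1 := by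
          rw [Real.log_le_iff_le_exp (by norm_num)]
          linarith [Real.exp_one_gt_d9]
        rw [h3, Real.log_mul (by norm_num) (by positivity)]
        linarith
      calc 1161 * ((thin p A ε e).card / (3 * ε / 4) ^ 2) *
            Real.log (576 / (3 * ε / 4 * (δ / 2)))
          ≤ 1161 * ((A.card / 4) / (3 * ε / 4) ^ 2) * (2 * Real.log (576 / (ε * δ))) := by
            have := one_le_log (ε := 3 * ε / 4) (δ := δ / 2) (by linarith) (by linarith)
              (by linarith) (by linarith)
            gcongr
            exact card_thin_le p hε hε1 (not_le.1 hA) e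
        _ = 1032 * X := by
            rw [hX]
            field_simp
            ring

theorem weight_mem_Icc {ν : Fin n → Measure ℝ} (hν : IsBandit ν) (a : Fin n) :
    weight ν a ∈ Icc (0 : ℝ) 1 := by
  have := (hν a).1
  have hint : Integrable (fun x : ℝ => x) (ν a) :=
    Integrable.of_mem_Icc 0 1 aemeasurable_id (hν a).2
  refine ⟨integral_nonneg_of_ae ((hν a).2.mono fun x hx => hx.1), ?_⟩
  have := integral_mono_ae hint (integrable_const (1 : ℝ)) ((hν a).2.mono fun x hx => hx.2)
  simpa [weight] using this

theorem le_prob_sampleAll_accurate {ν : Fin n → Measure ℝ} (hν : IsBandit ν)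
    {A : Finset (Fin n)} {ε δ : ℝ} (hε : 0 < ε) (hε1 : ε ≤ 1) (hδ : 0 < δ) (hδ1 : δ ≤ 1)
    (hA : (A.card : ℝ) ≤ 72 / ε) :
    ENNReal.ofReal (1 - δ) ≤ (sampleAll (numSamples ε δ) A.toList).prob ν
      fun e => ∀ a ∈ A, |e a - weight ν a| ≤ ε / 16 := by
  refine le_trans (ENNReal.ofReal_le_ofReal ?_) (le_prob_sampleAll hν
    (numSamples_pos hε hε1 hδ hδ1) (by positivity) (exp_numSamples_le hε hδ) A (w := fun _ => 1)
    (fun _ => zero_le_one) fun e he => ?_)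
  · have : (A.card : ℝ) * (ε * δ / 288) ≤ 72 / ε * (ε * δ / 288) := by gcongr
    have h2 : 72 / ε * (ε * δ / 288) = δ / 4 := by field_simp; norm_num
    simp only [Finset.sum_const, nsmul_eq_mul, mul_one]
    linarith
  · push Not at he
    obtain ⟨a, ha, h⟩ := he
    simp only [Finset.sum_const, nsmul_eq_mul, mul_one, Nat.one_le_cast]
    exact Finset.card_pos.2 ⟨a, Finset.mem_filter.2 ⟨ha, h⟩⟩

theorem le_prob_sampleAll_covers {ν : Fin n → Measure ℝ} (hν : IsBandit ν) (p : Fin n → ℝ)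
    {A : Finset (Fin n)} {ε δ : ℝ} (hε : 0 < ε) (hε1 : ε ≤ 1) (hδ : 0 < δ) (hδ1 : δ ≤ 1) :
    ENNReal.ofReal (1 - δ / 2) ≤ (sampleAll (numSamples ε δ) A.toList).prob ν
      fun e => Covers (weight ν) p (thin p A ε e) A (ε / 4) := by
  classical
  obtain ⟨T, hTA, hTcard, hT⟩ := exists_targets (weight ν) p A (ε / 8) (⌊8 / ε⌋₊ + 1)
  set m := ⌊ε * A.card / 72⌋₊ with hm
  have hm1 : ε * A.card / 72 < m + 1 := Nat.lt_floor_add_one _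
  -- One bad target, or m + 1 bad arms, already has weight 1. All weights together are at most 72/ε
  -- + 9/ε, so failure has probability at most 81δ/288 ≤ δ/2.
  refine le_trans (ENNReal.ofReal_le_ofReal ?_) (le_prob_sampleAll hν
    (numSamples_pos hε hε1 hδ hδ1) (θ := ε / 16) (by positivity) (exp_numSamples_le hε hδ) A
    (w := fun a => 1 / (m + 1) + if a ∈ T then 1 else 0)
    (fun a => by split_ifs <;> positivity) fun e he => ?_)
  · have h1 : ∑ a ∈ A, (1 / ((m : ℝ) + 1) + if a ∈ T then 1 else 0) =
        A.card / (m + 1) + T.card := by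
      rw [Finset.sum_add_distrib, Finset.sum_ite_mem, Finset.inter_eq_right.2 hTA]
      simp [div_eq_mul_inv]
    have h2 : (A.card : ℝ) / (m + 1) ≤ 72 / ε := by
      rw [div_le_div_iff₀ (by positivity) hε]
      linarith
    have h3 : (T.card : ℝ) ≤ 9 / ε := by
      have h4 : (T.card : ℝ) ≤ ⌊8 / ε⌋₊ + 1 := by exact_mod_cast hTcard
      have := Nat.floor_le (show 0 ≤ 8 / ε by positivity)
      have : 1 ≤ 1 / ε := (one_le_div hε).2 hε1
      have : 9 / ε = 8 / ε + 1 / ε := by ring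
      linarith
    have h4 : ((A.card : ℝ) / (m + 1) + T.card) * (ε * δ / 288) ≤
        (72 / ε + 9 / ε) * (ε * δ / 288) := by gcongr
    have h5 : (72 / ε + 9 / ε) * (ε * δ / 288) = 81 / 288 * δ := by field_simp; norm_num
    rw [h1]
    linarith
  · by_contra! hlt
    refine he (covers_thin hε (weight_mem_Icc hν) hTA hT (fun t ht => ?_) ?_)
    · by_contra! h
      have := Finset.single_le_sum (f := fun a => 1 / ((m : ℝ) + 1) + if a ∈ T then 1 else 0)
        (s := A.filter fun a => ε / 16 < |e a - weight ν a|)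
        (fun a _ => by split_ifs <;> positivity) (Finset.mem_filter.2 ⟨hTA ht, h⟩)
      simp only [ht, if_true] at this
      have : 0 < 1 / ((m : ℝ) + 1) := by positivity
      linarith
    · by_contra! h
      have h1 : (m : ℝ) + 1 ≤ (A.filter fun a => ε / 16 < |e a - weight ν a|).card := by
        exact_mod_cast h
      have h2 : ((A.filter fun a => ε / 16 < |e a - weight ν a|).card : ℝ) * (1 / (m + 1)) ≤
          ∑ a ∈ A with ε / 16 < |e a - weight ν a|,
            (1 / ((m : ℝ) + 1) + if a ∈ T then 1 else 0) := by
        rw [← nsmul_eq_mul]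
        refine Finset.card_nsmul_le_sum _ _ _ fun a _ => ?_
        split_ifs <;> linarith
      have h3 : 1 ≤ ((A.filter fun a => ε / 16 < |e a - weight ν a|).card : ℝ) *
          (1 / (m + 1)) := by
        rw [mul_one_div]
        exact (one_le_div (by positivity)).2 h1
      linarith

/-- Thinning strictly shrinks A, so |A| rounds suffice. Accuracy adds up as ε/4 + 3ε/4 and
confidence as δ/2 + δ/2. -/
theorem le_prob_sky {ν : Fin n → Measure ℝ} (hν : IsBandit ν) (p : Fin n → ℝ) {k : ℕ}
    {A : Finset (Fin n)} (hk : A.card ≤ k) {ε δ : ℝ} (hε : 0 < ε)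
    (hε1 : ε ≤ 1) (hδ : 0 < δ) (hδ1 : δ ≤ 1) :
    ENNReal.ofReal (1 - δ) ≤ (sky p k A ε δ).prob ν (IsSkyline (weight ν) p A ε) := by
  induction k generalizing A ε δ with
  | zero =>
    have : A = ∅ := by simpa using hk
    subst this
    exact le_prob_ret (by simp [IsSkyline]) hδ.le
  | succ k ih =>
    rw [sky]
    split_ifs with hA
    · exact le_prob_bind_ret hδ.le (le_prob_sampleAll_accurate hν hε hε1 hδ hδ1 hA) fun e he =>
        isSkyline_empiricalSkyline he (by linarith) (by linarith)
    · have h : ∀ e, Covers (weight ν) p (thin p A ε e) A (ε / 4) → ENNReal.ofReal (1 - δ / 2) ≤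
          (sky p k (thin p A ε e) (3 * ε / 4) (δ / 2)).prob ν (IsSkyline (weight ν) p A ε) := by
        intro e he
        have h1 := card_thin_le p hε hε1 (not_le.1 hA) e
        have h2 : (0 : ℝ) < A.card := lt_trans (by positivity) (not_le.1 hA)
        have h3 : ((thin p A ε e).card : ℝ) < A.card := by linarith
        have h4 : (thin p A ε e).card < A.card := by exact_mod_cast h3
        refine (ih (by omega) (by linarith) (by linarith) (by linarith) (by linarith)).trans
          (prob_mono (fun L hL => ?_) _)
        have := hL.of_covers (by positivity) (thin_subset p A ε e) he
        rwa [show 3 * ε / 4 + ε / 4 = ε by ring] at this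
      have h' := le_prob_bind (by positivity) (by positivity)
        (le_prob_sampleAll_covers hν p hε hε1 hδ hδ1) h
      rwa [add_halves] at h'

/-! ### From `sky` to the three subroutines. -/

theorem mem_arms {p : Fin n → ℝ} {lo hi : EReal} {a : Fin n} :
    a ∈ arms p lo hi ↔ lo ≤ (p a : EReal) ∧ (p a : EReal) ≤ hi := by
  simp [arms]

theorem arms_neg (p : Fin n → ℝ) (lo hi : EReal) :
    arms (fun a => -p a) (-hi) (-lo) = arms p lo hi := by
  ext a
  simp only [mem_arms, EReal.coe_neg, EReal.neg_le_neg_iff]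
  exact and_comm

theorem max_one_log_mul_le {k x C : ℝ} (hk : 0 < k) (hx : 0 < x) (hkC : Real.log k ≤ C)
    (hC : 0 ≤ C) : max 1 (Real.log (k * x)) ≤ (C + 1) * max 1 (Real.log x) := by
  have h1 := le_max_left 1 (Real.log x)
  have h2 := le_max_right 1 (Real.log x)
  refine max_le ?_ ?_
  · nlinarith
  · rw [Real.log_mul hk.ne' hx.ne']
    nlinarith

theorem IsSkyline.isLeftSkyline {μ p : Fin n → ℝ} {lo hi : EReal} {ε : ℝ}
    {L : List (Fin n × ℝ)} (h : IsSkyline μ p (arms p lo hi) ε L) :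
    IsLeftSkyline μ p lo hi ε {a | a ∈ L.map Prod.fst} := by
  obtain ⟨h1, h2, h3, -⟩ := h
  have hsub : ∀ b ∈ arms p lo hi, ∀ d, d ∈ arms p (p b) hi → d ∈ arms p lo hi ∧ p b ≤ p d := by
    intro b hb d hd
    rw [mem_arms] at hb hd
    exact ⟨mem_arms.2 ⟨hb.1.trans hd.1, hd.2⟩, EReal.coe_le_coe_iff.1 hd.1⟩
  refine ⟨fun c hc => ?_, fun b hb => ?_, fun c hc => ?_⟩
  · obtain ⟨x, hx, rfl⟩ := List.mem_map.1 hc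
    exact h1 x hx
  · obtain ⟨x, hx, hbx, hopt⟩ := h2 b hb
    exact ⟨x.1, List.mem_map_of_mem hx,
      mem_arms.2 ⟨EReal.coe_le_coe_iff.2 hbx, (mem_arms.1 (h1 x hx)).2⟩,
      fun d hd => hopt d (hsub b hb d hd).1 (hsub b hb d hd).2⟩
  · obtain ⟨x, hx, rfl⟩ := List.mem_map.1 hc
    have hxA := h1 x hx
    exact ⟨x.1, hxA, mem_arms.2 ⟨le_rfl, (mem_arms.1 hxA).2⟩,
      fun d hd => h3 x hx d (hsub _ hxA d hd).1 (hsub _ hxA d hd).2⟩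

theorem EpsOptimal.neg {μ p : Fin n → ℝ} {lo hi : EReal} {ε : ℝ} {a : Fin n}
    (h : EpsOptimal μ (fun a => -p a) (-hi) (-lo) ε a) : EpsOptimal μ p lo hi ε a := by
  rwa [EpsOptimal, arms_neg] at h

theorem IsLeftSkyline.neg {μ p : Fin n → ℝ} {lo hi : EReal} {ε : ℝ} {L : Set (Fin n)}
    (h : IsLeftSkyline μ (fun a => -p a) (-hi) (-lo) ε L) : IsRightSkyline μ p lo hi ε L := by
  simp only [IsLeftSkyline, arms_neg, EReal.coe_neg] at h
  exact ⟨h.1, fun b hb => (h.2.1 b hb).imp fun c hc => ⟨hc.1, hc.2.neg⟩,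
    fun c hc => (h.2.2 c hc).imp fun b hb => ⟨hb.1, hb.2.neg⟩⟩

/-- The skyline arm serving b loses ε/3 against b, and comparing estimates loses ε/3 twice. -/
theorem IsSkyline.findsEpsOptimal_argmax {μ p : Fin n → ℝ} {lo hi : EReal} {ε : ℝ}
    {L : List (Fin n × ℝ)} (hε : 0 < ε) (h : IsSkyline μ p (arms p lo hi) (ε / 3) L) :
    FindsEpsOptimal μ p lo hi ε ((L.argmax Prod.snd).map Prod.fst) ∧
      ∀ x ∈ L.argmax Prod.snd, |μ x.1 - x.2| ≤ ε := by
  obtain ⟨h1, h2, -, h4⟩ := h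
  refine ⟨⟨fun a ha => ?_, fun ⟨b, hb⟩ => ?_⟩, fun x hx => ?_⟩
  · obtain ⟨x, hx, rfl⟩ := Option.mem_map.1 ha
    have hxL := List.argmax_mem hx
    refine ⟨h1 x hxL, fun b hb => ?_⟩
    obtain ⟨y, hy, -, hopt⟩ := h2 b hb
    have := hopt b hb le_rfl
    have := List.le_of_mem_argmax hy hx
    have := abs_le.1 (h4 x hxL)
    have := abs_le.1 (h4 y hy)
    linarith
  · obtain ⟨y, hy, -⟩ := h2 b hb
    rw [Option.isSome_map, Option.isSome_iff_ne_none]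
    intro h
    rw [List.argmax_eq_none] at h
    simp [h] at hy
  · exact (h4 x (List.argmax_mem hx)).trans (by linarith)

/-- Find a left skyline; if the accuracy or the confidence parameter is trivial then so is the
procedure. -/
noncomputable def leftSkyline (p : Fin n → ℝ) (lo hi : EReal) (ε δ : ℝ) :
    Strategy n (List (Fin n × ℝ)) :=
  open Classical in
  if ε ≤ 1 ∧ δ ≤ 1 then sky p n (arms p lo hi) ε δ
  else .ret ((arms p lo hi).toList.map fun a => (a, 1 / 2))

theorem le_prob_leftSkyline {ν : Fin n → Measure ℝ} (hν : IsBandit ν) (p : Fin n → ℝ)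
    (lo hi : EReal) {ε δ : ℝ} (hε : 0 < ε) (hδ : 0 < δ) :
    ENNReal.ofReal (1 - δ) ≤
      (leftSkyline p lo hi ε δ).prob ν (IsSkyline (weight ν) p (arms p lo hi) ε) := by
  rw [leftSkyline]
  split_ifs with h
  · exact le_prob_sky hν p (card_finset_fin_le _) hε h.1 hδ h.2
  · rcases lt_or_ge 1 δ with hδ1 | hδ1
    · rw [ENNReal.ofReal_of_nonpos (by linarith)]
      exact zero_le
    · have hε1 : 1 < ε := by
        by_contra! hc
        exact h ⟨hc, hδ1⟩
      have hmem : ∀ x ∈ (arms p lo hi).toList.map fun a => (a, (1 / 2 : ℝ)),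
          x.1 ∈ arms p lo hi ∧ x.2 = 1 / 2 := by
        intro x hx
        obtain ⟨a, ha, rfl⟩ := List.mem_map.1 hx
        exact ⟨Finset.mem_toList.1 ha, rfl⟩
      have hw := weight_mem_Icc hν
      refine le_prob_ret ⟨fun x hx => (hmem x hx).1, fun b hb =>
        ⟨(b, 1 / 2), List.mem_map.2 ⟨b, Finset.mem_toList.2 hb, rfl⟩, le_rfl, fun d _ _ => ?_⟩,
        fun x _ d _ _ => ?_, fun x hx => ?_⟩ hδ.le
      · linarith [(hw b).1, (hw d).2]
      · linarith [(hw x.1).1, (hw d).2]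
      · rw [(hmem x hx).2, abs_le]
        constructor <;> linarith [(hw x.1).1, (hw x.1).2]

theorem leftSkyline_drawsAtMost (p : Fin n → ℝ) (lo hi : EReal) {ε δ : ℝ} (hε : 0 < ε)
    (hδ : 0 < δ) : (leftSkyline p lo hi ε δ).DrawsAtMost
      (9288 * ((arms p lo hi).card / ε ^ 2) * max 1 (Real.log (1 / (ε * δ)))) := by
  have hmax := le_max_left 1 (Real.log (1 / (ε * δ)))
  rw [leftSkyline]
  split_ifs with h
  · refine (sky_drawsAtMost p n _ hε h.1 hδ h.2).mono ?_
    -- Absorbing 576 costs a factor 7 + 1, whence 9288 = 8 · 1161.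
    have h576 : Real.log 576 ≤ 7 := by
      rw [Real.log_le_iff_le_exp (by norm_num)]
      calc (576 : ℝ) ≤ 2.7 ^ 7 := by norm_num
        _ ≤ Real.exp 1 ^ 7 := by
          gcongr
          linarith [Real.exp_one_gt_d9]
        _ = Real.exp 7 := by rw [← Real.exp_nat_mul]; norm_num
    have hlog := (le_max_right _ _).trans (max_one_log_mul_le (by norm_num)
      (show 0 < 1 / (ε * δ) by positivity) h576 (by norm_num))
    rw [mul_one_div] at hlog
    calc _ ≤ 1161 * ((arms p lo hi).card / ε ^ 2) *
          ((7 + 1) * max 1 (Real.log (1 / (ε * δ)))) := by gcongr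
      _ = _ := by ring
  · change 0 ≤ _
    positivity

/-- Subroutines that are all based on `leftSkyline`. -/
noncomputable def skylineSubroutines : Subroutines where
  best p lo hi ε δ := (leftSkyline p lo hi (ε / 3) δ).bind fun L => .ret (L.argmax Prod.snd)
  lsky p lo hi ε δ := leftSkyline p lo hi ε δ
  rsky p lo hi ε δ := leftSkyline (fun a => -p a) (-hi) (-lo) ε δ

theorem skylineSubroutines_correct : skylineSubroutines.Correct := by
  intro n p lo hi ε δ hε hδ ν hν
  refine ⟨?_, ?_, ?_⟩
  · exact le_prob_bind_ret hδ.le (le_prob_leftSkyline hν p lo hi (by positivity) hδ)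
      fun L hL => hL.findsEpsOptimal_argmax hε
  · exact (le_prob_leftSkyline hν p lo hi hε hδ).trans
      (prob_mono (fun L hL => ⟨hL.isLeftSkyline, hL.2.2.2⟩) _)
  · exact (le_prob_leftSkyline hν _ _ _ hε hδ).trans
      (prob_mono (fun L hL => ⟨hL.isLeftSkyline.neg, hL.2.2.2⟩) _)

theorem skylineSubroutines_sampleBound : skylineSubroutines.SampleBound 250776 := by
  intro n p lo hi ε δ hε hδ N
  have hmax := le_max_left 1 (Real.log (1 / (ε * δ)))
  have hN : 9288 * ((arms p lo hi).card / ε ^ 2) * max 1 (Real.log (1 / (ε * δ))) ≤ N := by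
    simp only [N]
    gcongr
    norm_num
  refine ⟨?_, (leftSkyline_drawsAtMost p lo hi hε hδ).mono hN, ?_⟩
  · refine ((leftSkyline_drawsAtMost p lo hi (show 0 < ε / 3 by positivity) hδ).bind_ret).mono ?_
    have h3 : Real.log 3 ≤ 2 :=
      (Real.log_le_sub_one_of_pos (by norm_num)).trans (by norm_num)
    have hlog := max_one_log_mul_le (by norm_num)
      (show 0 < 1 / (ε * δ) by positivity) h3 (by norm_num)
    rw [show 3 * (1 / (ε * δ)) = 1 / (ε / 3 * δ) by field_simp] at hlog
    calc _ ≤ 9288 * ((arms p lo hi).card / (ε / 3) ^ 2) *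
          ((2 + 1) * max 1 (Real.log (1 / (ε * δ)))) := by gcongr
      _ = N := by
        simp only [N]
        ring
  · have := leftSkyline_drawsAtMost (fun a => -p a) (-hi) (-lo) hε hδ
    rw [arms_neg] at this
    exact this.mono hN

/-! ### Geometry of the slabs. -/

section SlabEndpoint

variable (H : Finset ℝ)

theorem slabEndpoint_succ_of_lt {j : ℕ} (hj : j < H.card) :
    slabEndpoint H (j + 1) = ((H.sort (· ≤ ·))[j]'(by simpa using hj) : ℝ) := by
  have : j < ((H.sort (· ≤ ·)).map fun x : ℝ => (x : EReal)).length := by simpa using hj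
  rw [slabEndpoint, List.getD_cons_succ, List.getD_eq_getElem _ _ this, List.getElem_map]

theorem slabEndpoint_card_succ : slabEndpoint H (H.card + 1) = ⊤ := by
  rw [slabEndpoint, List.getD_cons_succ, List.getD_eq_default]
  simp

theorem slabEndpoint_lt_succ {j : ℕ} (hj : j ≤ H.card) :
    slabEndpoint H j < slabEndpoint H (j + 1) := by
  rcases hj.lt_or_eq with hj | rfl
  · rw [slabEndpoint_succ_of_lt H hj]
    cases j with
    | zero => exact EReal.bot_lt_coe _
    | succ j =>
      rw [slabEndpoint_succ_of_lt H (by omega), EReal.coe_lt_coe_iff]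
      exact H.sortedLT_sort.getElem_lt_getElem_of_lt (Nat.lt_succ_self j)
  · rw [slabEndpoint_card_succ]
    cases h : H.card with
    | zero => exact bot_lt_top
    | succ k =>
      rw [slabEndpoint_succ_of_lt H (by omega)]
      exact EReal.coe_lt_top _

theorem slabEndpoint_le {j k : ℕ} (hjk : j ≤ k) (hk : k ≤ H.card + 1) :
    slabEndpoint H j ≤ slabEndpoint H k := by
  induction k, hjk using Nat.le_induction with
  | base => exact le_rfl
  | succ k _ ih => exact (ih (by omega)).trans (slabEndpoint_lt_succ H (by omega)).le

theorem exists_slabEndpoint_eq {e : ℝ} (he : e ∈ H) :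
    ∃ k ≤ H.card, slabEndpoint H k = e := by
  obtain ⟨j, hj, rfl⟩ := List.getElem_of_mem ((Finset.mem_sort (· ≤ ·)).2 he)
  rw [Finset.length_sort] at hj
  exact ⟨j + 1, hj, slabEndpoint_succ_of_lt H hj⟩

theorem exists_mem_slab (x : ℝ) :
    ∃ j < H.card + 1, slabEndpoint H j ≤ x ∧ (x : EReal) ≤ slabEndpoint H (j + 1) := by
  classical
  have hex : ∃ j, (x : EReal) ≤ slabEndpoint H (j + 1) :=
    ⟨H.card, by rw [slabEndpoint_card_succ]; exact le_top⟩
  refine ⟨Nat.find hex, Nat.lt_succ_of_le (Nat.find_min' hex ?_), ?_, Nat.find_spec hex⟩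
  · rw [slabEndpoint_card_succ]; exact le_top
  · cases h : Nat.find hex with
    | zero => exact bot_le
    | succ k => exact (not_le.1 (Nat.find_min hex (h ▸ Nat.lt_succ_self k))).le

theorem slab_disjoint_hittingSet {e : ℝ} (he : e ∈ H) {j : ℕ} (hj : j < H.card + 1) :
    (e : EReal) ≤ slabEndpoint H j ∨ slabEndpoint H (j + 1) ≤ e := by
  obtain ⟨k, hk, hke⟩ := exists_slabEndpoint_eq H he
  rw [← hke]
  rcases Nat.lt_or_ge j k with h | h
  · exact .inr (slabEndpoint_le H h (by omega))
  · exact .inl (slabEndpoint_le H h (by omega))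

theorem card_slabs_le (x : EReal) : ((Finset.range (H.card + 1)).filter fun j =>
    slabEndpoint H j ≤ x ∧ x ≤ slabEndpoint H (j + 1)).card ≤ 2 := by
  set F := (Finset.range (H.card + 1)).filter fun j =>
    slabEndpoint H j ≤ x ∧ x ≤ slabEndpoint H (j + 1) with hF
  rcases F.eq_empty_or_nonempty with h | h
  · simp [h]
  · have hmin := F.min'_mem h
    set m := F.min' h
    refine (Finset.card_le_card (t := {m, m + 1}) fun k hk => ?_).trans Finset.card_le_two
    have hmk := F.min'_le k hk
    rw [hF, Finset.mem_filter, Finset.mem_range] at hmin hk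
    by_contra hne
    simp only [Finset.mem_insert, Finset.mem_singleton, not_or] at hne
    have hlt : m + 2 ≤ k := by
      have : m ≤ k := hmk
      omega
    -- Slabs m and k ≥ m + 2 are disjoint, as the endpoints increase strictly; only neighbours share
    -- a point.
    have h1 := slabEndpoint_lt_succ H (j := m + 1) (by omega)
    have h2 := slabEndpoint_le H hlt (by omega)
    exact absurd (hk.2.1.trans hmin.2.2) (not_le.2 (h1.trans_le h2))

theorem sum_card_arms_slab_le (p : Fin n → ℝ) :
    ∑ j ∈ Finset.range (H.card + 1),
      (arms p (slabEndpoint H j) (slabEndpoint H (j + 1))).card ≤ 2 * n := by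
  classical
  simp_rw [arms, Finset.card_filter]
  rw [Finset.sum_comm]
  simp_rw [← Finset.card_filter]
  refine (Finset.sum_le_card_nsmul _ _ 2 fun a _ => card_slabs_le H (p a)).trans ?_
  simp [mul_comm]

end SlabEndpoint

/-! ### Number of draws of Alg-RS. -/

section DrawBound

variable {S : Subroutines} {c : ℝ}

theorem slabCandidates_drawsAtMost (hS : S.SampleBound c) (p : Fin n → ℝ) (H : Finset ℝ)
    {ε δ : ℝ} (hε : 0 < ε) (hδ : 0 < δ) (j : ℕ) :
    (slabCandidates S p H ε δ j).DrawsAtMost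
      (3 * (c * ((arms p (slabEndpoint H j) (slabEndpoint H (j + 1))).card / (ε / 3) ^ 2) *
        max 1 (Real.log (1 / (ε / 3 * (δ / (3 * (H.card + 1)))))))) := by
  obtain ⟨h1, h2, h3⟩ := hS n p (slabEndpoint H j) (slabEndpoint H (j + 1)) (ε / 3)
    (δ / (3 * (H.card + 1))) (by positivity) (by positivity)
  exact (h1.bind fun _ => h2.bind fun _ => h3.bind_ret).mono (le_of_eq (by ring))

theorem candidates_drawsAtMost (hS : S.SampleBound c) (p : Fin n → ℝ) (H : Finset ℝ)
    {ε δ : ℝ} (hε : 0 < ε) (hδ : 0 < δ) (m : ℕ) :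
    (candidates S p H ε δ m).DrawsAtMost
      (∑ j ∈ Finset.range m,
        3 * (c * ((arms p (slabEndpoint H j) (slabEndpoint H (j + 1))).card / (ε / 3) ^ 2) *
          max 1 (Real.log (1 / (ε / 3 * (δ / (3 * (H.card + 1)))))))) := by
  induction m with
  | zero => exact le_rfl
  | succ m ih =>
    rw [Finset.sum_range_succ]
    exact ih.bind fun _ => (slabCandidates_drawsAtMost hS p H hε hδ m).bind_ret

/-- 216 = 3 · 9 · 2 · 4: three calls per slab, accuracy ε/3, each arm in at most two slabs, and a
factor 4 from the logarithm. For the last, τ ≥ 1 gives 9(τ + 1) ≤ 18τ. -/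
theorem algRS_drawsAtMost (hc : 0 < c) (hS : S.SampleBound c) {q : ℕ} (p : Fin n → ℝ)
    (ℓ r : Fin q → ℝ) {H : Finset ℝ} (hH : H.Nonempty) {ε δ : ℝ} (hε : 0 < ε) (hδ : 0 < δ) :
    (algRS S p ℓ r H ε δ).DrawsAtMost
      (216 * c * (n / ε ^ 2) * max 1 (Real.log (H.card / (ε * δ)))) := by
  refine ((candidates_drawsAtMost hS p H hε hδ _).bind_ret).mono ?_
  have hτ : (1 : ℝ) ≤ H.card := by exact_mod_cast hH.card_pos
  have hmax := le_max_left 1 (Real.log (H.card / (ε * δ)))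
  have h18 : Real.log 18 ≤ 3 := by
    rw [Real.log_le_iff_le_exp (by norm_num)]
    calc (18 : ℝ) ≤ 2.7 ^ 3 := by norm_num
      _ ≤ Real.exp 1 ^ 3 := by
        gcongr
        linarith [Real.exp_one_gt_d9]
      _ = Real.exp 3 := by rw [← Real.exp_nat_mul]; norm_num
  have hlog : max 1 (Real.log (1 / (ε / 3 * (δ / (3 * (H.card + 1)))))) ≤
      4 * max 1 (Real.log (H.card / (ε * δ))) := by
    refine le_trans ?_ ((max_one_log_mul_le (by norm_num)
      (show 0 < H.card / (ε * δ) by positivity) h18 (by norm_num)).trans_eq (by norm_num))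
    gcongr
    rw [div_le_iff₀ (by positivity)]
    have : 18 * (H.card / (ε * δ)) * (ε / 3 * (δ / (3 * (H.card + 1)))) =
        2 * H.card / (H.card + 1 : ℝ) := by
      field_simp
      norm_num
    rw [this, le_div_iff₀ (by positivity)]
    linarith
  have hsum : ∑ j ∈ Finset.range (H.card + 1),
      ((arms p (slabEndpoint H j) (slabEndpoint H (j + 1))).card : ℝ) ≤ 2 * n := by
    exact_mod_cast sum_card_arms_slab_le H p
  calc _ = 27 * c / ε ^ 2 * (∑ j ∈ Finset.range (H.card + 1),
        ((arms p (slabEndpoint H j) (slabEndpoint H (j + 1))).card : ℝ)) *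
        max 1 (Real.log (1 / (ε / 3 * (δ / (3 * (H.card + 1)))))) := by
        rw [Finset.mul_sum, Finset.sum_mul]
        refine Finset.sum_congr rfl fun j _ => ?_
        ring
    _ ≤ 27 * c / ε ^ 2 * (2 * n) * (4 * max 1 (Real.log (H.card / (ε * δ)))) := by gcongr
    _ = _ := by ring

end DrawBound

/-! ### Correctness of Alg-RS. -/

/-- For every arm of the interval, the list contains arms that are as good up to `η`, one that lies
in the interval, one that moreover lies to the right and one that lies to the left. -/
def ServesInterval (μ p : Fin n → ℝ) (lo hi : EReal) (η : ℝ) (C : List (Fin n × ℝ)) : Prop :=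
  ∀ b ∈ arms p lo hi, (∃ x ∈ C, x.1 ∈ arms p lo hi ∧ μ b - η ≤ μ x.1) ∧
    (∃ x ∈ C, x.1 ∈ arms p (p b) hi ∧ μ b - η ≤ μ x.1) ∧
    ∃ x ∈ C, x.1 ∈ arms p lo (p b) ∧ μ b - η ≤ μ x.1

theorem ServesInterval.mono {μ p : Fin n → ℝ} {lo hi : EReal} {η : ℝ} {C D : List (Fin n × ℝ)}
    (h : ServesInterval μ p lo hi η C) (hCD : C ⊆ D) : ServesInterval μ p lo hi η D := by
  intro b hb
  obtain ⟨⟨x, hx, hx'⟩, ⟨y, hy, hy'⟩, z, hz, hz'⟩ := h b hb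
  exact ⟨⟨x, hCD hx, hx'⟩, ⟨y, hCD hy, hy'⟩, z, hCD hz, hz'⟩

section Correctness

variable {S : Subroutines} {ν : Fin n → Measure ℝ}

theorem le_prob_slabCandidates (hS : S.Correct) (hν : IsBandit ν) (p : Fin n → ℝ) (H : Finset ℝ)
    {ε δ : ℝ} (hε : 0 < ε) (hδ : 0 < δ) (j : ℕ) :
    ENNReal.ofReal (1 - δ / (H.card + 1)) ≤ (slabCandidates S p H ε δ j).prob ν fun D =>
      (∀ x ∈ D, |weight ν x.1 - x.2| ≤ ε / 3) ∧
        ServesInterval (weight ν) p (slabEndpoint H j) (slabEndpoint H (j + 1)) (ε / 3) D := by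
  have hδ' : 0 < δ / (3 * ((H.card : ℝ) + 1)) := by positivity
  obtain ⟨h1, h2, h3⟩ := hS n p (slabEndpoint H j) (slabEndpoint H (j + 1)) (ε / 3)
    (δ / (3 * (H.card + 1))) (by positivity) hδ' ν hν
  rw [show δ / ((H.card : ℝ) + 1) = δ / (3 * (H.card + 1)) +
    (δ / (3 * (H.card + 1)) + δ / (3 * (H.card + 1))) by field_simp; norm_num]
  refine le_prob_bind hδ'.le (by positivity) h1 fun β hβ =>
    le_prob_bind hδ'.le hδ'.le h2 fun L hL => le_prob_bind_ret hδ'.le h3 fun R hR => ?_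
  obtain ⟨⟨hβ1, hβ2⟩, hβ3⟩ := hβ
  obtain ⟨⟨-, hL1, -⟩, hL2⟩ := hL
  obtain ⟨⟨-, hR1, -⟩, hR2⟩ := hR
  refine ⟨fun x hx => ?_, fun b hb => ⟨?_, ?_, ?_⟩⟩
  · simp only [List.mem_append, Option.mem_toList] at hx
    rcases hx with (hx | hx) | hx
    · exact hβ3 x hx
    · exact hL2 x hx
    · exact hR2 x hx
  · have hsome := hβ2 ⟨b, hb⟩
    rw [Option.isSome_map, Option.isSome_iff_exists] at hsome
    obtain ⟨x, rfl⟩ := hsome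
    obtain ⟨hx, hopt⟩ := hβ1 x.1 rfl
    exact ⟨x, by simp, hx, hopt b hb⟩
  · obtain ⟨c, hc, hcA, hopt⟩ := hL1 b hb
    obtain ⟨x, hx, rfl⟩ := List.mem_map.1 hc
    exact ⟨x, by simp [hx], hcA, hopt b (mem_arms.2 ⟨le_rfl, (mem_arms.1 hb).2⟩)⟩
  · obtain ⟨c, hc, hcA, hopt⟩ := hR1 b hb
    obtain ⟨x, hx, rfl⟩ := List.mem_map.1 hc
    exact ⟨x, by simp [hx], hcA, hopt b (mem_arms.2 ⟨(mem_arms.1 hb).1, le_rfl⟩)⟩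

theorem le_prob_candidates (hS : S.Correct) (hν : IsBandit ν) (p : Fin n → ℝ) (H : Finset ℝ)
    {ε δ : ℝ} (hε : 0 < ε) (hδ : 0 < δ) (m : ℕ) :
    ENNReal.ofReal (1 - m * (δ / (H.card + 1))) ≤ (candidates S p H ε δ m).prob ν fun C =>
      (∀ x ∈ C, |weight ν x.1 - x.2| ≤ ε / 3) ∧ ∀ j < m,
        ServesInterval (weight ν) p (slabEndpoint H j) (slabEndpoint H (j + 1)) (ε / 3) C := by
  induction m with
  | zero => exact le_prob_ret (by simp) (by simp)
  | succ m ih =>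
    rw [Nat.cast_succ, add_one_mul]
    refine le_prob_bind (by positivity) (by positivity) ih fun C hC =>
      le_prob_bind_ret (by positivity) (le_prob_slabCandidates hS hν p H hε hδ m) fun D hD =>
        ⟨fun x hx => ?_, fun j hj => ?_⟩
    · rcases List.mem_append.1 hx with hx | hx
      · exact hC.1 x hx
      · exact hD.1 x hx
    · rcases Nat.lt_succ_iff_lt_or_eq.1 hj with hj | rfl
      · exact (hC.2 j hj).mono (List.subset_append_left _ _)
      · exact hD.2.mono (List.subset_append_right _ _)

end Correctness

theorem exists_candidate {μ p : Fin n → ℝ} {H : Finset ℝ} {η ℓ r e : ℝ}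
    {C : List (Fin n × ℝ)} (hC : ∀ j < H.card + 1,
      ServesInterval μ p (slabEndpoint H j) (slabEndpoint H (j + 1)) η C)
    (he : e ∈ H) (hℓe : ℓ < e) (her : e < r) {b : Fin n} (hb : b ∈ arms p ℓ r) :
    ∃ x ∈ C, x.1 ∈ arms p ℓ r ∧ μ b - η ≤ μ x.1 := by
  obtain ⟨j, hj, hjb, hbj⟩ := exists_mem_slab H (p b)
  obtain ⟨⟨x, hx, hxA, hxμ⟩, ⟨y, hy, hyA, hyμ⟩, z, hz, hzA, hzμ⟩ :=
    hC j hj b (mem_arms.2 ⟨hjb, hbj⟩)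
  rw [mem_arms] at hb hxA hyA hzA
  have hℓe' : (ℓ : EReal) ≤ e := EReal.coe_le_coe_iff.2 hℓe.le
  have her' : (e : EReal) ≤ r := EReal.coe_le_coe_iff.2 her.le
  rcases le_total (ℓ : EReal) (slabEndpoint H j) with h1 | h1
  · rcases le_total (slabEndpoint H (j + 1)) (r : EReal) with h2 | h2
    · exact ⟨x, hx, mem_arms.2 ⟨h1.trans hxA.1, hxA.2.trans h2⟩, hxμ⟩
    -- The query may end inside the slab, but it contains the part left of b, so a right-skyline arm
    -- fits.
    · exact ⟨z, hz, mem_arms.2 ⟨h1.trans hzA.1, hzA.2.trans hb.2⟩, hzμ⟩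
  -- The slab starts no later than the query; since e > ℓ is not interior to the slab, the slab ends
  -- by e < r and a left-skyline arm fits.
  · have h2 : slabEndpoint H (j + 1) ≤ r := by
      rcases slab_disjoint_hittingSet H he hj with h | h
      · exact absurd (h.trans h1) (not_le.2 (EReal.coe_lt_coe_iff.2 hℓe))
      · exact h.trans her'
    exact ⟨y, hy, mem_arms.2 ⟨hb.1.trans hyA.1, hyA.2.trans h2⟩, hyμ⟩

theorem findsEpsOptimal_select {μ p : Fin n → ℝ} {lo hi : EReal} {ε : ℝ}
    {C : List (Fin n × ℝ)} (hest : ∀ x ∈ C, |μ x.1 - x.2| ≤ ε / 3)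
    (hC : ∀ b ∈ arms p lo hi, ∃ x ∈ C, x.1 ∈ arms p lo hi ∧ μ b - ε / 3 ≤ μ x.1) :
    FindsEpsOptimal μ p lo hi ε (select p lo hi C) := by
  refine ⟨fun a ha => ?_, fun ⟨b, hb⟩ => ?_⟩
  · obtain ⟨x, hx, rfl⟩ := Option.mem_map.1 ha
    have hxC := List.argmax_mem hx
    simp only [List.mem_filter, decide_eq_true_eq] at hxC
    refine ⟨hxC.2, fun b hb => ?_⟩
    obtain ⟨y, hy, hyA, hyμ⟩ := hC b hb
    have := List.le_of_mem_argmax (show y ∈ C.filter _ by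
      simp only [List.mem_filter, decide_eq_true_eq]; exact ⟨hy, hyA⟩) hx
    have := abs_le.1 (hest x hxC.1)
    have := abs_le.1 (hest y hy)
    linarith
  · obtain ⟨y, hy, hyA, -⟩ := hC b hb
    rw [select, Option.isSome_map, Option.isSome_iff_ne_none, Ne, List.argmax_eq_none,
      List.filter_eq_nil_iff]
    exact fun h => h y hy (by simpa using hyA)

theorem le_prob_algRS {S : Subroutines} (hS : S.Correct) {ν : Fin n → Measure ℝ}
    (hν : IsBandit ν) {q : ℕ} (p : Fin n → ℝ) {ℓ r : Fin q → ℝ} {H : Finset ℝ}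
    (hH : IsHittingSet ℓ r H) {ε δ : ℝ} (hε : 0 < ε) (hδ : 0 < δ) :
    ENNReal.ofReal (1 - δ) ≤ (algRS S p ℓ r H ε δ).prob ν fun α =>
      ∀ i, FindsEpsOptimal (weight ν) p (ℓ i) (r i) ε (α i) := by
  have h := le_prob_candidates hS hν p H hε hδ (H.card + 1)
  rw [Nat.cast_succ, mul_div_cancel₀ _ (by positivity)] at h
  refine le_prob_bind_ret hδ.le h fun C hC i => findsEpsOptimal_select hC.1 fun b hb => ?_
  obtain ⟨e, he, hℓe, her⟩ := hH i
  exact exists_candidate hC.2 he hℓe her hb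

end BRS

theorem mainTheorem1 :
    (∃ c : ℝ, 0 < c ∧ ∃ S : BRS.Subroutines, S.Correct ∧ S.SampleBound c) ∧
    ∀ c : ℝ, 0 < c → ∃ K : ℝ, 0 < K ∧
      ∀ S : BRS.Subroutines, S.Correct → S.SampleBound c →
      ∀ (n q : ℕ) (p : Fin n → ℝ) (ℓ r : Fin q → ℝ) (H : Finset ℝ) (ε δ : ℝ),
        0 < q → (∀ i, ℓ i < r i) → BRS.IsMinHittingSet ℓ r H → 0 < ε → 0 < δ →
        (BRS.algRS S p ℓ r H ε δ).DrawsAtMost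
            (K * (n / ε ^ 2) * max 1 (Real.log (H.card / (ε * δ)))) ∧
        ∀ ν : Fin n → MeasureTheory.Measure ℝ, BRS.IsBandit ν →
          ENNReal.ofReal (1 - δ) ≤ (BRS.algRS S p ℓ r H ε δ).prob ν (fun α =>
            ∀ i, BRS.FindsEpsOptimal (BRS.weight ν) p (ℓ i) (r i) ε (α i)) := by
  refine ⟨⟨250776, by norm_num, BRS.skylineSubroutines, BRS.skylineSubroutines_correct,
    BRS.skylineSubroutines_sampleBound⟩, fun c hc => ⟨216 * c, by positivity, ?_⟩⟩
  intro S hS hSc n q p ℓ r H ε δ hq _ hH hε hδ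
  obtain ⟨e, he, -⟩ := hH.1 ⟨0, hq⟩
  exact ⟨BRS.algRS_drawsAtMost hc hSc p ℓ r ⟨e, he⟩ hε hδ,
    fun ν hν => BRS.le_prob_algRS hS hν p hH.1 hε hδ⟩
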